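/- Let $A=\mathbb{Z}[V^{\pm1},v^{\pm1}]$ with field of fractions $K$, let $W_3=\langle t,s_1,s_2\rangle$ be the Coxeter group of type $B_3$ ($t s_1$ of order $4$, $s_1s_2$ of order $3$, $t s_2$ of order $2$), and let $\mathcal{H}_3$ be its generic Iwahori–Hecke algebra over $A$, with $T_t^2=1+(V-V^{-1})T_t$ and $T_{s_i}^2=1+(v-v^{-1})T_{s_i}$. A total order on the monomials $V^iv^j$ determines the Kazhdan–Lusztig basis $(C_w)$ of $\mathcal{H}_3$ ($C_w$ is bar-invariant and $C_w-T_w$ is a combination of elements $T_y$, $y\ne w$, with coefficients spanned by monomials $<1$), the left cells $\mathfrak C$ of $W_3$, and the left cell modules $[\mathfrak C]_A$ with basis $e_w$ (the class of $C_w$), $w\in\mathfrak C$; write $[\mathfrak C]_K=K\otimes_A[\mathfrak C]_A$. Let $\lambda=((1),(2))$ and let $\tilde S^\lambda=M^\lambda/(M^\lambda\cap\hat N^\lambda)$ be the Dipper–James–Murphy Specht module, where $M^\lambda=\mathcal{H}_3x_\lambda$ and $\hat N^\lambda=\sum_\mu \mathcal{H}_3x_\mu\mathcal{H}_3$, the sum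 being over the bipartitions $\mu\neq\lambda$ of $3$ that dominate $\lambda$. Here, for a bipartition $\mu=(\mu_1,\mu_2)$ with $|\mu_1|=l$, $x_\mu=u_l^+\sum_{w\in\mathfrak S_\mu}v^{\ell(w)}T_w$, where $\mathfrak S_\mu$ is the row stabiliser (in $\langle s_1,s_2\rangle$) of the canonical bitableau of shape $\mu$ and $u_l^+=\prod_{i=1}^{l}(v^{2(i-1)}+T_{i-1}\cdots T_1T_0T_1\cdots T_{i-1})$ with $T_0=VT_t$, $T_i=vT_{s_i}$. Put $p_1=Vv^{-1}+V^{-1}v$ and $p_2=Vv^{-2}+V^{-1}v^2$. Matrices act on coordinate columns with respect to the listed bases. (a) For the pure lexicographic order (compare $i$, then $j$), $\mathfrak C_\lambda=\{s_2t,\ s_1s_2t,\ s_2s_1s_2t\}$ is a left cell, $\tilde S^\lambda\cong[\mathfrak C_\lambda]_A$ as $\mathcal{H}_3$-modules, and in the basis $(e_w)$, in this order, $[\mathfrak C_\lambda]_A$ affords $$\rho_\lambda:\ T_t\mapsto\begin{pmatrix}V&p_1&p_2\\0&-V^{-1}&0\\0&0&-V^{-1}\end{pmatrix},\quad T_{s_1}\mapsto\begin{pmatrix}-v^{-1}&0&0\\1&v&0\\0&0&v\end{pmatrix},\quad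 T_{s_2}\mapsto\begin{pmatrix}v&1&0\\0&-v^{-1}&0\\0&1&v\end{pmatrix}.$$ Now consider the weighted lexicographic order: $V^iv^j<V^{i'}v^{j'}$ if and only if $i+j<i'+j'$, or $i+j=i'+j'$ and $i<i'$. (b) For $y\in\{1,t,ts_1\}$ the sets $\{s_1s_2s_1y,\ s_1ts_1s_2s_1y,\ ts_1s_2s_1y\}$ are three distinct left cells for this order, and in the basis $(e_w)$, in this order, each of their cell modules affords $$\rho:\ T_t\mapsto\begin{pmatrix}-V^{-1}&0&0\\0&-V^{-1}&0\\1&p_1&V\end{pmatrix},\quad T_{s_1}\mapsto\begin{pmatrix}v&0&0\\0&v&1\\0&0&-v^{-1}\end{pmatrix},\quad T_{s_2}\mapsto\begin{pmatrix}v&p_2&0\\0&-v^{-1}&0\\0&1&v\end{pmatrix}.$$ A left cell $\mathfrak C$ for this order satisfies $[\mathfrak C]_K\cong K\otimes_A\tilde S^\lambda$ if and only if it is one of these three. (c) The matrix $P=\begin{pmatrix}0&0&p_2\\0&1&0\\1&0&0\end{pmatrix}$ satisfies $P\rho_\lambda(T_s)=\rho(T_s)P$ for $s\in\{t,s_1,s_2\}$;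 every $Q\in M_3(K)$ with $Q\rho_\lambda(T_s)=\rho(T_s)Q$ for all $s$ is a $K$-multiple of $P$; and there is no $a\in K$ with $aP\in M_3(A)$ and $\det(aP)\in A^\times$. (d) Consequently, for the weighted lexicographic order, $\tilde S^\lambda$ is not isomorphic, as an $\mathcal{H}_3$-module, to $[\mathfrak C]_A$ for any left cell $\mathfrak C$ of $W_3$. -/

import Mathlib

open scoped TensorProduct

noncomputable section

/-! ## Generic Iwahori-Hecke algebras and Kazhdan-Lusztig cells -/

namespace KazhdanLusztig

/-- The group ring `ℤ[Γ]` of an (additively written) abelian group `Γ`. -/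
abbrev Coeff (Γ : Type*) [AddCommGroup Γ] : Type _ := AddMonoidAlgebra ℤ Γ

/-- The basis element `ε^γ` of `ℤ[Γ]`. -/
def eps {Γ : Type*} [AddCommGroup Γ] (γ : Γ) : Coeff Γ := AddMonoidAlgebra.single γ 1

section General

variable {B : Type*} (M : CoxeterMatrix B) {Γ : Type*} [AddCommGroup Γ] (L : B → Γ)

/-- The defining relations of the generic Iwahori-Hecke algebra with parameters `v_s = ε^(L s)`:
the quadratic relations `T_s² = 1 + (v_s - v_s⁻¹) T_s` and the braid relations. -/
inductive HeckeRel : FreeAlgebra (Coeff Γ) B → FreeAlgebra (Coeff Γ) B → Prop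
  | quadratic (i : B) :
      HeckeRel (FreeAlgebra.ι (Coeff Γ) i * FreeAlgebra.ι (Coeff Γ) i)
        (1 + (eps (L i) - eps (-L i)) • FreeAlgebra.ι (Coeff Γ) i)
  | braid (i j : B) :
      HeckeRel ((CoxeterSystem.braidWord M i j).map (FreeAlgebra.ι (Coeff Γ))).prod
        ((CoxeterSystem.braidWord M j i).map (FreeAlgebra.ι (Coeff Γ))).prod

/-- The generic Iwahori-Hecke algebra `H(W, S, L)` over `ℤ[Γ]`, where `W` is the Coxeter group of
`M`.  Here `L` is the restriction to the simple reflections of a weight function on `W` (a function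
on the simple reflections extends to a weight function if and only if it is constant on
conjugate simple reflections). For such `L`, the algebra is free with basis `(T_w)`, and
`T_s T_w` is `T_{sw}` if `ℓ(sw) > ℓ(w)` and `T_{sw} + (v_s - v_s⁻¹) T_w` otherwise. -/
def Hecke : Type _ := RingQuot (HeckeRel M L)

instance : Ring (Hecke M L) := inferInstanceAs (Ring (RingQuot (HeckeRel M L)))

instance : Algebra (Coeff Γ) (Hecke M L) :=
  inferInstanceAs (Algebra (Coeff Γ) (RingQuot (HeckeRel M L)))

/-- The generator `T_s` of the Hecke algebra. -/
def gen (i : B) : Hecke M L :=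
  show RingQuot (HeckeRel M L) from
  RingQuot.mkAlgHom (Coeff Γ) (HeckeRel M L) (FreeAlgebra.ι (Coeff Γ) i)

/-- A reduced expression of `w`. -/
def reducedWord (w : M.Group) : List B :=
  Classical.choose (M.toCoxeterSystem.exists_isReduced w)

/-- The element `T_w` of the Hecke algebra, the product of the generators along a
reduced expression of `w` (by the braid relations it does not depend on the expression). -/
def T (w : M.Group) : Hecke M L := ((reducedWord M w).map (gen M L)).prod

/-- The self-dual elements: those fixed by the bar involution, which is the ring
homomorphism with `ε^γ ↦ ε^(-γ)` and `T_s ↦ T_s⁻¹`. -/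
def IsSelfDual (h : Hecke M L) : Prop :=
  ∃ bar : Hecke M L →+* Hecke M L,
    (∀ γ : Γ, bar (algebraMap (Coeff Γ) (Hecke M L) (eps γ)) =
      algebraMap (Coeff Γ) (Hecke M L) (eps (-γ))) ∧
    (∀ i : B, bar (gen M L i) * gen M L i = 1 ∧ gen M L i * bar (gen M L i) = 1) ∧
    bar h = h

/-- Membership in `A_{<0}` for a strict order `lt` on `Γ`. -/
def IsNegative (lt : Γ → Γ → Prop) (a : Coeff Γ) : Prop :=
  ∀ γ : Γ, a.coeff γ ≠ 0 → lt γ 0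

/-- The property characterising `C_w`: it is self-dual, and it is the sum of `T_w` and
an `A_{<0}`-combination of elements `T_y` with `y ≠ w`. (There is exactly one such element for each
`w` when all `L s` are positive; only elements `y` below `w` in the Bruhat order then occur.) -/
def IsKL (lt : Γ → Γ → Prop) (w : M.Group) (c : Hecke M L) : Prop :=
  IsSelfDual M L c ∧
    ∃ p : M.Group →₀ Coeff Γ, p w = 0 ∧ (∀ y, IsNegative lt (p y)) ∧
      c = T M L w + p.sum fun y a => a • T M L y

/-- The Kazhdan-Lusztig basis element `C_w` with respect to the order `lt`. -/
def C (lt : Γ → Γ → Prop) (w : M.Group) : Hecke M L := Classical.epsilon (IsKL M L lt w)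

/-- `C_z` occurs in `h` when `h` is expressed in the Kazhdan-Lusztig basis. -/
def Occurs (lt : Γ → Γ → Prop) (z : M.Group) (h : Hecke M L) : Prop :=
  ∃ f : M.Group →₀ Coeff Γ, f z ≠ 0 ∧ h = f.sum fun y a => a • C M L lt y

/-- The relation `z ← y`: for some simple reflection `s`, `C_z` occurs in `C_s C_y`. -/
def LeftStep (lt : Γ → Γ → Prop) (z y : M.Group) : Prop :=
  ∃ i : B, Occurs M L lt z (C M L lt (M.simple i) * C M L lt y)

/-- The left pre-order `≤_L`. -/
def LeftLE (lt : Γ → Γ → Prop) (z y : M.Group) : Prop :=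
  Relation.ReflTransGen (LeftStep M L lt) z y

/-- The left cells: the equivalence classes of the equivalence relation of `≤_L`. -/
def IsLeftCell (lt : Γ → Γ → Prop) (c : Set M.Group) : Prop :=
  ∃ w : M.Group, c = {y | LeftLE M L lt y w ∧ LeftLE M L lt w y}

/-- The left ideal `I_c` generated by the `C_y` with `y ≤_L w` for some `w ∈ c`. (By the
definition of `≤_L`, the `ℤ[Γ]`-span of these `C_y` is a left ideal already.) -/
def cellIdeal (lt : Γ → Γ → Prop) (c : Set M.Group) : Submodule (Hecke M L) (Hecke M L) :=
  Submodule.span (Hecke M L) {h | ∃ y, (∃ w ∈ c, LeftLE M L lt y w) ∧ h = C M L lt y}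

/-- The left ideal generated by the `C_y` with `y ≤_L w` for some `w ∈ c` and `y ∉ c`; for a
left cell `c` it is again the `ℤ[Γ]`-span of these `C_y`. -/
def cellIdealHat (lt : Γ → Γ → Prop) (c : Set M.Group) : Submodule (Hecke M L) (Hecke M L) :=
  Submodule.span (Hecke M L)
    {h | ∃ y, (∃ w ∈ c, LeftLE M L lt y w) ∧ y ∉ c ∧ h = C M L lt y}

/-- The cell module of a left cell `c`, a left module over the Hecke algebra. -/
abbrev CellModule (lt : Γ → Γ → Prop) (c : Set M.Group) : Type _ :=
  cellIdeal M L lt c ⧸ (cellIdealHat M L lt c).submoduleOf (cellIdeal M L lt c)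

/-- The class `e_w` of `C_w` in the cell module, for `w ∈ c`. -/
def cellClass (lt : Γ → Γ → Prop) (c : Set M.Group) (w : M.Group) (hw : w ∈ c) :
    CellModule M L lt c :=
  Submodule.Quotient.mk
    ⟨C M L lt w, Submodule.subset_span ⟨w, ⟨w, hw, Relation.ReflTransGen.refl⟩, rfl⟩⟩

/-- The elements `b j` span a matrix representation: `T_i` acts on them by the matrix `ρ i`
(the `j`-th column of which gives the coordinates of the image of `b j`). -/
def ActsBy {X : Type*} [AddCommGroup X] [Module (Coeff Γ) X] [Module (Hecke M L) X]
    {ι : Type*} [Fintype ι] (b : ι → X) (ρ : B → Matrix ι ι (Coeff Γ)) : Prop :=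
  ∀ (i : B) (j : ι), gen M L i • b j = ∑ k, ρ i k j • b k

/-- After extension of scalars to the field of fractions `K` of `A = ℤ[Γ]`, the modules `X` and `Y`
over the Hecke algebra become isomorphic: there is a `K`-linear isomorphism `K ⊗ X ≃ K ⊗ Y` that
commutes with the action of the Hecke algebra. -/
def IsoOverFractions (X Y : Type*)
    [AddCommGroup X] [Module (Coeff Γ) X] [Module (Hecke M L) X]
    [IsScalarTower (Coeff Γ) (Hecke M L) X]
    [AddCommGroup Y] [Module (Coeff Γ) Y] [Module (Hecke M L) Y]
    [IsScalarTower (Coeff Γ) (Hecke M L) Y] : Prop :=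
  ∃ f : (FractionRing (Coeff Γ) ⊗[Coeff Γ] X) ≃ₗ[FractionRing (Coeff Γ)]
      (FractionRing (Coeff Γ) ⊗[Coeff Γ] Y),
    ∀ (h : Hecke M L) (x : FractionRing (Coeff Γ) ⊗[Coeff Γ] X),
      f ((Algebra.lsmul (Coeff Γ) (Coeff Γ) X h).baseChange (FractionRing (Coeff Γ)) x) =
        (Algebra.lsmul (Coeff Γ) (Coeff Γ) Y h).baseChange (FractionRing (Coeff Γ)) (f x)

end General

/-! ## Type `B_n` -/

/-- The Coxeter matrix of type `B_n`, numbered so that the generator `t` has index `0` and the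
generator `s_i` has index `i`, for `1 ≤ i ≤ n - 1`. -/
def typeB (n : ℕ) : CoxeterMatrix (Fin n) := (CoxeterMatrix.B n).reindex Fin.revPerm

/-- The weights: `(1, 0)` for `t` and `(0, 1)` for every `s_i`. -/
def weightB (n : ℕ) (i : Fin n) : ℤ × ℤ := if (i : ℕ) = 0 then (1, 0) else (0, 1)

/-- The ring `A = ℤ[V^{±1}, v^{±1}]`. -/
abbrev A : Type := Coeff (ℤ × ℤ)

/-- The monomial `V^i v^j`. -/
def mon (i j : ℤ) : A := eps (i, j)

/-- The Coxeter group `W_n` of type `B_n`. -/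
abbrev WB (n : ℕ) : Type := (typeB n).Group

/-- The generic two-parameter Hecke algebra of type `B_n`. -/
abbrev HB (n : ℕ) : Type := Hecke (typeB n) (weightB n)

/-- The lexicographic order on `ℤ²` (the asymptotic case). -/
def ltAsym (p q : ℤ × ℤ) : Prop := p.1 < q.1 ∨ (p.1 = q.1 ∧ p.2 < q.2)

/-- The weighted lexicographic order on `ℤ²`: compare `i + j` first, and then `i`. -/
def ltWeighted (p q : ℤ × ℤ) : Prop :=
  p.1 + p.2 < q.1 + q.2 ∨ (p.1 + p.2 = q.1 + q.2 ∧ p.1 < q.1)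

/-- A bipartition `(λ₁ | λ₂)` of `n`. -/
structure Bipartition (n : ℕ) where
  fst : List ℕ
  snd : List ℕ
  fst_sorted : fst.Pairwise (· ≥ ·)
  snd_sorted : snd.Pairwise (· ≥ ·)
  fst_pos : ∀ k ∈ fst, 0 < k
  snd_pos : ∀ k ∈ snd, 0 < k
  sum_eq : fst.sum + snd.sum = n

/-- The dominance order on bipartitions: `Dominated lam mu` says that `mu` dominates `lam`. -/
def Dominated {n : ℕ} (lam mu : Bipartition n) : Prop :=
  (∀ j : ℕ, (lam.fst.take j).sum ≤ (mu.fst.take j).sum) ∧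
  ∀ j : ℕ, lam.fst.sum + (lam.snd.take j).sum ≤ mu.fst.sum + (mu.snd.take j).sum

section Specht

variable {n : ℕ}

/-- The row stabiliser in the symmetric group `⟨s_1, …, s_{n-1}⟩` of the canonical bitableau of
shape `lam`, which has the numbers `1, …, n` in order in the rows of the first and then of the
second component: the parabolic subgroup generated by those `s_i` for which `i` is not a partial sum
of the list of all row lengths. -/
def youngSubgroup (lam : Bipartition n) : Subgroup (WB n) :=
  Subgroup.closure {w | ∃ i : Fin n, (i : ℕ) ≠ 0 ∧
    (∀ k : ℕ, ((lam.fst ++ lam.snd).take k).sum ≠ (i : ℕ)) ∧ w = (typeB n).simple i}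

/-- The sum of `v^{ℓ(w)} T_w` over the (finite) row stabiliser; it is the product of
the factors belonging to the two components of `lam`. -/
def rowSum (lam : Bipartition n) : HB n :=
  ∑ᶠ w ∈ (youngSubgroup lam : Set (WB n)),
    mon 0 ((typeB n).toCoxeterSystem.length w : ℤ) • T (typeB n) (weightB n) w

/-- The generators in the normalisation of Dipper, James and Murphy: `T_0 = V T_t` and
`T_i = v T_{s_i}` (so that `(T_0 - Q)(T_0 + 1) = 0` and `(T_i - q)(T_i + 1) = 0` where `Q = V²` and
`q = v²`). Indices `i ≥ n` are not used. -/
def djmGen (n i : ℕ) : HB n :=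
  if h : i < n then eps (weightB n ⟨i, h⟩) • gen (typeB n) (weightB n) ⟨i, h⟩ else 1

/-- The element `T_i ⋯ T_1 T_0 T_1 ⋯ T_i`. -/
def jucysMurphy (n : ℕ) : ℕ → HB n
  | 0 => djmGen n 0
  | i + 1 => djmGen n (i + 1) * jucysMurphy n i * djmGen n (i + 1)

/-- The element `u_l⁺`, the product of the (commuting) elements
`q^{i-1} + T_{i-1} ⋯ T_1 T_0 T_1 ⋯ T_{i-1}` for `1 ≤ i ≤ l`, where `q = v²`. -/
def uPlus (n l : ℕ) : HB n :=
  ((List.range l).map fun i : ℕ =>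
    algebraMap A (HB n) (mon 0 (2 * (i : ℤ))) + jucysMurphy n i).prod

/-- The element `x_λ` of Dipper, James and Murphy. -/
def xElt (lam : Bipartition n) : HB n := uPlus n lam.fst.sum * rowSum lam

/-- The left ideal `M^λ = H x_λ`. -/
def spechtM (lam : Bipartition n) : Submodule (HB n) (HB n) := Submodule.span (HB n) {xElt lam}

/-- The two-sided ideal `∑ H x_μ H`, summed over all `μ ≠ λ` dominating `λ`, as a left
ideal. -/
def spechtNHat (lam : Bipartition n) : Submodule (HB n) (HB n) :=
  Submodule.span (HB n)
    {y | ∃ mu : Bipartition n, Dominated lam mu ∧ lam ≠ mu ∧ ∃ h : HB n, y = xElt mu * h}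

/-- The Specht module of Dipper, James and Murphy, `M^λ / (M^λ ∩ N̂^λ)`. -/
abbrev Specht (lam : Bipartition n) : Type :=
  spechtM lam ⧸ (spechtM lam ⊓ spechtNHat lam).submoduleOf (spechtM lam)

end Specht

/-! ## Data in type `B_3` -/

/-- The bipartition `((1), (2))`. -/
def lam12 : Bipartition 3 where
  fst := [1]
  snd := [2]
  fst_sorted := by simp
  snd_sorted := by simp
  fst_pos := by simp
  snd_pos := by simp
  sum_eq := by simp

/-- The element of `W_3` given by a word in the generators `t`, `s_1`, `s_2` (with
indices `0`, `1`, `2`). -/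
def elt (ω : List (Fin 3)) : WB 3 := (typeB 3).toCoxeterSystem.wordProd ω

/-- The elements `s_2 t`, `s_1 s_2 t`, `s_2 s_1 s_2 t`. -/
def asymElt : Fin 3 → WB 3 := ![elt [2, 0], elt [1, 2, 0], elt [2, 1, 2, 0]]

/-- For each of `y = 1`, `y = t` and `y = t s_1`, the elements
`s_1 s_2 s_1 y`, `s_1 t s_1 s_2 s_1 y`, `t s_1 s_2 s_1 y`. -/
def weightedElt (k : Fin 3) : Fin 3 → WB 3 :=
  let y : WB 3 := (![elt [], elt [0], elt [0, 1]] : Fin 3 → WB 3) k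
  ![elt [1, 2, 1] * y, elt [1, 0, 1, 2, 1] * y, elt [0, 1, 2, 1] * y]

/-- The Laurent polynomial `V v⁻¹ + V⁻¹ v`. -/
def p1 : A := mon 1 (-1) + mon (-1) 1

/-- The Laurent polynomial `V v⁻² + V⁻¹ v²`. -/
def p2 : A := mon 1 (-2) + mon (-1) 2

/-- The matrices of `T_t`, `T_{s_1}`, `T_{s_2}` in the representation `ρ_λ`. -/
def rhoLam : Fin 3 → Matrix (Fin 3) (Fin 3) A :=
  ![!![mon 1 0, p1, p2; 0, -mon (-1) 0, 0; 0, 0, -mon (-1) 0],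
    !![-mon 0 (-1), 0, 0; 1, mon 0 1, 0; 0, 0, mon 0 1],
    !![mon 0 1, 1, 0; 0, -mon 0 (-1), 0; 0, 1, mon 0 1]]

/-- The matrices of `T_t`, `T_{s_1}`, `T_{s_2}` in the representation `ρ`. -/
def rho : Fin 3 → Matrix (Fin 3) (Fin 3) A :=
  ![!![-mon (-1) 0, 0, 0; 0, -mon (-1) 0, 0; 1, p1, mon 1 0],
    !![mon 0 1, 0, 0; 0, mon 0 1, 1; 0, 0, -mon 0 (-1)],
    !![mon 0 1, p2, 0; 0, -mon 0 (-1), 0; 0, 1, mon 0 1]]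

/-- The matrix `P`. -/
def matP : Matrix (Fin 3) (Fin 3) A := !![0, 0, p2; 0, 1, 0; 1, 0, 0]

/-- The field of fractions `K` of `A`. -/
abbrev K : Type := FractionRing A

/-- The cell module of a subset of `W_3` with respect to the order `lt`. -/
abbrev CellModuleB3 (lt : ℤ × ℤ → ℤ × ℤ → Prop) (c : Set (WB 3)) : Type :=
  CellModule (typeB 3) (weightB 3) lt c

end KazhdanLusztig

end

/-! The Kazhdan–Lusztig bases for both orders are computed, and the rest is read off from them. For
each order a finite table of structure constants serves as a certificate. It determines 48 elements
recursively in coordinates with respect to (T_w), and evaluation shows that they are unitriangular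
with coefficients in A_{<0} and multiply as the table says (`checkAll_asym`, `checkAll_weighted`).
Bar-invariance then follows by induction (`barH_tabElt`), so the uniqueness of the Kazhdan–Lusztig
basis (`isKL_unique`) identifies these elements with the C_w. This uses that (T_w) is a basis of the
algebra given by generators and relations, which comes from the regular representation
(`linearIndependent_tB`). The left cells are the strongly connected components of the resulting
graph (`IsWGraph.isLeftCell_iff`), and a cell module is given by the structure constants inside the
cell (`IsWGraph.exists_cellBasis`).

The Specht module: x_λ is Vv C_{s_2t}, so M^λ is the left ideal of the cell of s_2t. Every μ in the
definition of N̂^λ has |μ_1| ≥ 2, so N̂^λ is the two-sided ideal generated by u_2^+. A multiple of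
u_2^+ is C_{ts_1s_2t} up to a unit, and this element generates all that lies strictly below the cell
(`basis_mem_spechtNHat`). Conversely u_2^+ annihilates the cell module while x_λ acts on e_{s_2t} by
a non-zero scalar, so M^λ ∩ N̂^λ is no larger (`inf_le_cellIdealHat`).

For the weighted order, P has determinant -p_2 ≠ 0 and gives an isomorphism over K with each of the
three cell modules. Traces of T_t and T_{s_1} exclude all other cells (`trace_distinguishes`). An
isomorphism over A would have a matrix aP. An entry 1 of P forces a ∈ A, and the determinant -a³p_2
is not a unit because p_2 vanishes at V = v = 1 modulo 2. -/

noncomputable section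

namespace KazhdanLusztig

open CoxeterSystem

/-! ## The multiplication table of `W_3`

The 48 elements of `W_3` are numbered in the short-lexicographic order of their reduced expressions.
-/

/-- The table of left multiplication by a generator: the pair of decimal digits at position `k`,
counted from the right, is the number of the product with the element number `k`. -/
def lmCode (i : Fin 3) : ℕ :=
  if i = 0 then
    464743424544383736414039313029283534333223222120272625241514131219181716080706111009030205040001
  else if i = 1 then
    454147403534464433312726434239253823191837363217301511102928240922080504212016140301131207000602
  else
    444239473646323345282943242540412021373816173435121330310910262706072223041819021415011100080503

/-- The table of right multiplication by a generator, in the format of `lmCode`. -/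
def rmCode (i : Fin 3) : ℕ :=
  if i = 0 then
    464741423844453432433028314025393537213623183320271429241126101208220716191704151302030905060001
  else if i = 1 then
    454347394636353344312942412640243822372019341732153013282710250923072106051816031412110108000402
  else
    444240473746344533304329274139252338362135193216311528122611092422080620180417140213011000070503

/-- Left multiplication by a generator. -/
def lm (i : Fin 3) (k : Fin 48) : Fin 48 := Fin.ofNat 48 ((lmCode i / 100 ^ k.val) % 100)

/-- Right multiplication by a generator. -/
def rm (i : Fin 3) (k : Fin 48) : Fin 48 := Fin.ofNat 48 ((rmCode i / 100 ^ k.val) % 100)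

/-- The smallest left descent (a dummy value for the identity). -/
def hd (k : Fin 48) : Fin 3 := if lm 0 k < k then 0 else if lm 1 k < k then 1 else 2

/-- The length of the element number `k`. -/
def len (k : Fin 48) : ℕ := ([1, 4, 9, 16, 24, 32, 39, 44, 47].filter (· ≤ k.val)).length

theorem lm_lm : ∀ i k, lm i (lm i k) = k := by decide +kernel

theorem lm_ne : ∀ i k, lm i k ≠ k := by decide +kernel

theorem lm_hd_lt : ∀ k, k ≠ 0 → lm (hd k) k < k := by decide +kernel

/-- The thresholds in `len` are the numbers of the first elements of length 1, …, 9. Numbers grow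
with the length, so descents can be read off from the order on numbers. -/
theorem len_lm : ∀ i k, len (lm i k) = len k + 1 ∧ k < lm i k ∨
    len (lm i k) + 1 = len k ∧ lm i k < k := by decide +kernel

theorem len_zero : len 0 = 0 := by decide

theorem lm_rm : ∀ i j k, lm i (rm j k) = rm j (lm i k) := by decide +kernel

theorem rm_rm : ∀ i k, rm i (rm i k) = k := by decide +kernel

theorem exists_rm_lt : ∀ k, k ≠ 0 → ∃ i, rm i k < k := by decide +kernel

/-- Either s_i w = w s_j, and then the two generators are conjugate and have the same weight, or
multiplication on one side does not affect descents on the other. This is what makes left and right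
multiplication operators commute. -/
theorem lm_rm_cases : ∀ i j k,
    (lm i k = rm j k ∧ (i = 0 ↔ j = 0) ∧ (lm i k < k ↔ rm j k < k)) ∨
    (lm i k ≠ rm j k ∧ (lm i (rm j k) < rm j k ↔ lm i k < k) ∧
      (rm j (lm i k) < lm i k ↔ rm j k < k)) := by decide +kernel

theorem lt_lm_iff (i k) : k < lm i k ↔ ¬ lm i k < k :=
  ⟨fun h h' => lt_asymm h h', fun h => lt_of_le_of_ne (not_lt.1 h) (lm_ne i k).symm⟩

/-- Both s_i and s_j are left descents of s_i w, so s_i w is the longest element of its coset of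
⟨s_i, s_j⟩. This lemma and the next two list the two ascending paths to it from the shortest
element, for s_i s_j of order 2, 3 and 4. -/
theorem dihedral_two : ∀ i j : Fin 3, i ≠ j → i ≠ 1 → j ≠ 1 → ∀ k,
    k < lm i k → lm j (lm i k) < lm i k →
    lm j k < k ∧ lm j k < lm i (lm j k) ∧ lm i (lm j k) = lm j (lm i k) := by decide +kernel

theorem dihedral_three : ∀ i j : Fin 3, i ≠ j → i ≠ 0 → j ≠ 0 → ∀ k,
    k < lm i k → lm j (lm i k) < lm i k →
    ∃ x, x < k ∧ x < lm j x ∧ lm j x < k ∧ lm j x < lm i (lm j x) ∧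
      lm i (lm j x) = lm j (lm i k) ∧
      x < lm i x ∧ lm i x < k ∧ lm i x < lm j (lm i x) ∧ lm j (lm i x) = k := by decide +kernel

theorem dihedral_four : ∀ i j : Fin 3, i ≠ j → i ≠ 2 → j ≠ 2 → ∀ k,
    k < lm i k → lm j (lm i k) < lm i k →
    ∃ x, x < k ∧ x < lm i x ∧ lm i x < k ∧ lm i x < lm j (lm i x) ∧ lm j (lm i x) < k ∧
      lm j (lm i x) < lm i (lm j (lm i x)) ∧ lm i (lm j (lm i x)) = lm j (lm i k) ∧
      x < lm j x ∧ lm j x < k ∧ lm j x < lm i (lm j x) ∧ lm i (lm j x) < k ∧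
      lm i (lm j x) < lm j (lm i (lm j x)) ∧ lm j (lm i (lm j x)) = k := by decide +kernel

/-- A reduced expression of the element number `k`. -/
def wordOf (k : Fin 48) : List (Fin 3) :=
  if _h : k = 0 then [] else hd k :: wordOf (lm (hd k) k)
termination_by k.val
decreasing_by exact lm_hd_lt k _h

theorem wordOf_zero : wordOf 0 = [] := by rw [wordOf]; simp

theorem wordOf_of_ne {k : Fin 48} (h : k ≠ 0) : wordOf k = hd k :: wordOf (lm (hd k) k) := by
  rw [wordOf, dif_neg h]

theorem length_wordOf (k : Fin 48) : (wordOf k).length = len k := by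
  induction k using WellFoundedLT.induction with
  | ind k ih =>
    by_cases h : k = 0
    · subst h; rw [wordOf_zero, len_zero]; rfl
    · have h1 := lm_hd_lt k h
      rw [wordOf_of_ne h, List.length_cons, ih _ h1]
      rcases len_lm (hd k) k with h2 | h2
      · exact absurd h2.2 (lt_asymm h1)
      · exact h2.1

/-! ### Matsumoto's theorem for type B_3 -/

section Monoid

variable {R : Type*} [Monoid R]

/-- The product of the images of the generators along a reduced expression. -/
def wordVal (f : Fin 3 → R) (k : Fin 48) : R := ((wordOf k).map f).prod

theorem wordVal_zero (f : Fin 3 → R) : wordVal f 0 = 1 := by simp [wordVal, wordOf_zero]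

theorem wordVal_of_ne (f : Fin 3 → R) {k : Fin 48} (h : k ≠ 0) :
    wordVal f k = f (hd k) * wordVal f (lm (hd k) k) := by
  simp [wordVal, wordOf_of_ne h]

/-- The braid relations of type `B_3`. -/
structure BraidRel (f : Fin 3 → R) : Prop where
  four : f 0 * f 1 * f 0 * f 1 = f 1 * f 0 * f 1 * f 0
  three : f 1 * f 2 * f 1 = f 2 * f 1 * f 2
  two : f 0 * f 2 = f 2 * f 0

theorem BraidRel.of_ne_one {f : Fin 3 → R} (hf : BraidRel f) (i j : Fin 3) (h : i ≠ j)
    (hi : i ≠ 1) (hj : j ≠ 1) : f i * f j = f j * f i := by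
  obtain ⟨rfl, rfl⟩ | ⟨rfl, rfl⟩ : i = 0 ∧ j = 2 ∨ i = 2 ∧ j = 0 := by
    revert i j; decide
  exacts [hf.two, hf.two.symm]

theorem BraidRel.of_ne_zero {f : Fin 3 → R} (hf : BraidRel f) (i j : Fin 3) (h : i ≠ j)
    (hi : i ≠ 0) (hj : j ≠ 0) : f i * f j * f i = f j * f i * f j := by
  obtain ⟨rfl, rfl⟩ | ⟨rfl, rfl⟩ : i = 1 ∧ j = 2 ∨ i = 2 ∧ j = 1 := by
    revert i j; decide
  exacts [hf.three, hf.three.symm]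

theorem BraidRel.of_ne_two {f : Fin 3 → R} (hf : BraidRel f) (i j : Fin 3) (h : i ≠ j)
    (hi : i ≠ 2) (hj : j ≠ 2) : f i * f j * f i * f j = f j * f i * f j * f i := by
  obtain ⟨rfl, rfl⟩ | ⟨rfl, rfl⟩ : i = 0 ∧ j = 1 ∨ i = 1 ∧ j = 0 := by
    revert i j; decide
  exacts [hf.four, hf.four.symm]

theorem ne_two_of_ne (i j : Fin 3) (h : i ≠ j) (h2 : ¬(i ≠ 1 ∧ j ≠ 1)) (h3 : ¬(i ≠ 0 ∧ j ≠ 0)) :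
    i ≠ 2 ∧ j ≠ 2 := by
  revert i j; decide

/-- Left multiplication by a generator which increases the length. -/
theorem mul_wordVal {f : Fin 3 → R} (hf : BraidRel f) (k : Fin 48) :
    ∀ i, k < lm i k → f i * wordVal f k = wordVal f (lm i k) := by
  induction k using WellFoundedLT.induction with
  | ind k ih =>
    intro i hi
    have h0 : lm i k ≠ 0 := fun h => by rw [h] at hi; exact absurd hi (Fin.not_lt_zero k)
    rw [wordVal_of_ne f h0]
    have hj := lm_hd_lt _ h0
    -- The value at `lm i k` is defined through its smallest left descent j. If j ≠ i, both
    -- expressions of `lm i k` are traced down to the shortest element of the dihedral coset by the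
    -- induction hypothesis, and there they differ by a braid relation.
    set j := hd (lm i k) with hjd
    by_cases hij : i = j
    · rw [← hij, lm_lm]
    by_cases h2 : i ≠ 1 ∧ j ≠ 1
    · obtain ⟨a1, a2, a3⟩ := dihedral_two i j hij h2.1 h2.2 k hi hj
      rw [← a3, ← ih _ a1 i a2]
      conv_lhs => rw [← lm_lm j k, ← ih _ a1 j (by rw [lm_lm]; exact a1)]
      rw [← mul_assoc, hf.of_ne_one i j hij h2.1 h2.2, mul_assoc]
    by_cases h3 : i ≠ 0 ∧ j ≠ 0
    · obtain ⟨x, a0, a1, a2, a3, a4, b1, b2, b3, b4⟩ := dihedral_three i j hij h3.1 h3.2 k hi hj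
      rw [← a4, ← ih _ a2 i a3, ← ih _ a0 j a1]
      conv_lhs => rw [← b4, ← ih _ b2 j b3, ← ih _ a0 i b1]
      simp only [← mul_assoc]
      rw [hf.of_ne_zero i j hij h3.1 h3.2]
    · have h4 := ne_two_of_ne i j hij h2 h3
      obtain ⟨x, a0, a1, a2, a3, a4, a5, a6, b1, b2, b3, b4, b5, b6⟩ :=
        dihedral_four i j hij h4.1 h4.2 k hi hj
      rw [← a6, ← ih _ a4 i a5, ← ih _ a2 j a3, ← ih _ a0 i a1]
      conv_lhs => rw [← b6, ← ih _ b4 j b5, ← ih _ b2 i b3, ← ih _ a0 j b1]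
      simp only [← mul_assoc]
      rw [hf.of_ne_two i j hij h4.1 h4.2]

theorem wordVal_eq_mul {f : Fin 3 → R} (hf : BraidRel f) {k : Fin 48} {i : Fin 3}
    (hi : lm i k < k) : wordVal f k = f i * wordVal f (lm i k) := by
  rw [mul_wordVal hf _ i (by rwa [lm_lm]), lm_lm]

end Monoid

/-! ## The numbering of the group -/

theorem braidRel_of_braidWord {R : Type*} [Monoid R] {f : Fin 3 → R}
    (h : ∀ i j, ((braidWord (typeB 3) i j).map f).prod = ((braidWord (typeB 3) j i).map f).prod) :
    BraidRel f where
  four := by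
    have := h 0 1
    rw [show braidWord (typeB 3) 0 1 = [0, 1, 0, 1] from rfl,
      show braidWord (typeB 3) 1 0 = [1, 0, 1, 0] from rfl] at this
    simpa [mul_assoc] using this
  three := by
    have := h 1 2
    rw [show braidWord (typeB 3) 1 2 = [2, 1, 2] from rfl,
      show braidWord (typeB 3) 2 1 = [1, 2, 1] from rfl] at this
    simpa [mul_assoc] using this.symm
  two := by
    have := h 0 2
    rw [show braidWord (typeB 3) 0 2 = [0, 2] from rfl,
      show braidWord (typeB 3) 2 0 = [2, 0] from rfl] at this
    simpa using this

theorem BraidRel.braidWord {R : Type*} [Monoid R] {f : Fin 3 → R} (hf : BraidRel f) (i j : Fin 3) :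
    ((braidWord (typeB 3) i j).map f).prod = ((braidWord (typeB 3) j i).map f).prod := by
  have h1 : ((CoxeterSystem.braidWord (typeB 3) 0 1).map f).prod =
      ((CoxeterSystem.braidWord (typeB 3) 1 0).map f).prod := by
    rw [show CoxeterSystem.braidWord (typeB 3) 0 1 = [0, 1, 0, 1] from rfl,
      show CoxeterSystem.braidWord (typeB 3) 1 0 = [1, 0, 1, 0] from rfl]
    simpa [mul_assoc] using hf.four
  have h2 : ((CoxeterSystem.braidWord (typeB 3) 1 2).map f).prod =
      ((CoxeterSystem.braidWord (typeB 3) 2 1).map f).prod := by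
    rw [show CoxeterSystem.braidWord (typeB 3) 1 2 = [2, 1, 2] from rfl,
      show CoxeterSystem.braidWord (typeB 3) 2 1 = [1, 2, 1] from rfl]
    simpa [mul_assoc] using hf.three.symm
  have h3 : ((CoxeterSystem.braidWord (typeB 3) 0 2).map f).prod =
      ((CoxeterSystem.braidWord (typeB 3) 2 0).map f).prod := by
    rw [show CoxeterSystem.braidWord (typeB 3) 0 2 = [0, 2] from rfl,
      show CoxeterSystem.braidWord (typeB 3) 2 0 = [2, 0] from rfl]
    simpa using hf.two
  fin_cases i <;> fin_cases j <;>
    first | exact rfl | exact h1 | exact h1.symm | exact h2 | exact h2.symm | exact h3 | exact h3.symm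

/-- The Coxeter system of type `B_3`. -/
abbrev csB : CoxeterSystem (typeB 3) (WB 3) := (typeB 3).toCoxeterSystem

theorem lm_isLiftable : (typeB 3).IsLiftable
    fun i => (Function.Involutive.toPerm (lm i) (lm_lm i) : Equiv.Perm (Fin 48)) := by
  have h : ∀ i j k, ((fun x => lm i (lm j x))^[(typeB 3) i j]) k = k := by decide +kernel
  intro i j
  ext k : 1
  rw [Equiv.Perm.one_apply, Equiv.Perm.coe_pow]
  exact h i j k

/-- The action of `W_3` on the numbers of its elements by left multiplication. -/
def lmHom : WB 3 →* Equiv.Perm (Fin 48) := csB.lift ⟨_, lm_isLiftable⟩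

theorem lmHom_simple (i : Fin 3) (k : Fin 48) : lmHom (csB.simple i) k = lm i k := by
  rw [lmHom, csB.lift_apply_simple]; rfl

/-- The number of an element of `W_3`. -/
def idx (w : WB 3) : Fin 48 := lmHom w 0

theorem idx_one : idx 1 = 0 := by simp [idx]

theorem idx_simple_mul (i : Fin 3) (w : WB 3) : idx (csB.simple i * w) = lm i (idx w) := by
  rw [idx, map_mul, Equiv.Perm.mul_apply, lmHom_simple]; rfl

theorem idx_wordProd (ω : List (Fin 3)) : idx (csB.wordProd ω) = ω.foldr lm 0 := by
  induction ω with
  | nil => simp [idx_one]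
  | cons i ω ih => rw [wordProd_cons, idx_simple_mul, ih]; rfl

theorem braidRel_simple : BraidRel csB.simple :=
  braidRel_of_braidWord fun i j => csB.wordProd_braidWord_eq i j

/-- The element of `W_3` with a given number. -/
def elem (k : Fin 48) : WB 3 := wordVal csB.simple k

theorem simple_mul_elem (i : Fin 3) (k : Fin 48) : csB.simple i * elem k = elem (lm i k) := by
  by_cases h : lm i k < k
  · rw [elem, wordVal_eq_mul braidRel_simple h, simple_mul_simple_cancel_left]; rfl
  · exact mul_wordVal braidRel_simple k i ((lt_lm_iff i k).2 h)

/-- An element is recovered from its number by multiplying out the word of that number, so the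
action on numbers is free at 0. Together with `idx_elem` this shows that the table describes all of
W_3 without collapse. -/
theorem elem_idx (w : WB 3) : elem (idx w) = w := by
  induction w using csB.simple_induction_left with
  | one => rw [idx_one]; exact wordVal_zero _
  | mul_simple_left w i ih => rw [idx_simple_mul, ← simple_mul_elem, ih]

theorem idx_elem (k : Fin 48) : idx (elem k) = k := by
  induction k using WellFoundedLT.induction with
  | ind k ih =>
    by_cases h : k = 0
    · subst h; rw [elem, wordVal_zero, idx_one]
    · have h1 := lm_hd_lt k h
      rw [← lm_lm (hd k) k, ← simple_mul_elem, idx_simple_mul, ih _ h1]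

/-- The numbering of the elements of `W_3`. -/
def idxEquiv : WB 3 ≃ Fin 48 := ⟨idx, elem, elem_idx, idx_elem⟩

theorem idx_injective : Function.Injective idx := idxEquiv.injective

theorem len_foldr_le (ω : List (Fin 3)) : len (ω.foldr lm 0) ≤ ω.length := by
  induction ω with
  | nil => simp [len_zero]
  | cons i ω ih =>
    rw [List.foldr_cons, List.length_cons]
    rcases len_lm i (ω.foldr lm 0) with h | h <;> omega

/-- The word of a number bounds the length from above; the bound from below holds because each
letter raises `len` by at most one. -/
theorem length_eq_len (w : WB 3) : csB.length w = len (idx w) := by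
  apply le_antisymm
  · conv_lhs => rw [← elem_idx w]
    rw [← length_wordOf]
    exact csB.length_wordProd_le (wordOf (idx w))
  · obtain ⟨ω, hω, rfl⟩ := csB.exists_isReduced w
    rw [hω.eq, idx_wordProd]
    exact len_foldr_le ω

/-- Needed because `T` is defined through an arbitrarily chosen reduced expression. -/
theorem prod_map_of_isReduced {R : Type*} [Monoid R] {f : Fin 3 → R} (hf : BraidRel f)
    {ω : List (Fin 3)} (hω : csB.IsReduced ω) :
    (ω.map f).prod = wordVal f (idx (csB.wordProd ω)) := by
  induction ω with
  | nil => simp [idx_one, wordVal_zero]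
  | cons i ω ih =>
    have h1 : csB.IsReduced ω := by simpa using hω.drop 1
    have h2 := hω.eq
    rw [length_eq_len, wordProd_cons, idx_simple_mul, List.length_cons, ← h1.eq,
      length_eq_len] at h2
    rw [List.map_cons, List.prod_cons, ih h1, wordProd_cons, idx_simple_mul, mul_wordVal hf]
    rcases len_lm i (idx (csB.wordProd ω)) with h | h
    · exact h.2
    · omega

/-! ## The Hecke algebra of type `B_3` -/

/-- The generators of the Hecke algebra of type `B_3`. -/
abbrev gB (i : Fin 3) : HB 3 := gen (typeB 3) (weightB 3) i

/-- The parameter `v_i - v_i⁻¹`. -/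
def xi (i : Fin 3) : A := eps (weightB 3 i) - eps (-weightB 3 i)

theorem eps_mul_eps {Γ : Type*} [AddCommGroup Γ] (a b : Γ) : eps a * eps b = eps (a + b) := by
  simp [eps, AddMonoidAlgebra.single_mul_single]

theorem xi_congr {i j : Fin 3} (h : i = 0 ↔ j = 0) : xi i = xi j := by
  have : weightB 3 i = weightB 3 j := by revert i j; decide
  rw [xi, xi, this]

theorem gB_mul_gB (i : Fin 3) : gB i * gB i = 1 + xi i • gB i := by
  have h := RingQuot.mkAlgHom_rel A (HeckeRel.quadratic (M := typeB 3) (L := weightB 3) i)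
  rw [map_mul, map_add, map_one, map_smul] at h
  exact h

theorem braidRel_gB : BraidRel gB := by
  refine braidRel_of_braidWord fun i j => ?_
  have h := RingQuot.mkAlgHom_rel A (HeckeRel.braid (M := typeB 3) (L := weightB 3) i j)
  rw [map_list_prod, map_list_prod, List.map_map, List.map_map] at h
  exact h

/-- An induction principle for the Hecke algebra. -/
theorem hecke_induction {P : HB 3 → Prop} (hA : ∀ a : A, P (algebraMap A (HB 3) a))
    (hg : ∀ i, P (gB i)) (hm : ∀ x y, P x → P y → P (x * y))
    (ha : ∀ x y, P x → P y → P (x + y)) (h : HB 3) : P h := by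
  obtain ⟨x, rfl⟩ := RingQuot.mkAlgHom_surjective A (HeckeRel (typeB 3) (weightB 3)) h
  induction x using FreeAlgebra.induction with
  | grade0 a => rw [AlgHom.commutes]; exact hA a
  | grade1 i => exact hg i
  | mul x y hx hy => rw [map_mul]; exact hm _ _ hx hy
  | add x y hx hy => rw [map_add]; exact ha _ _ hx hy

/-! ### Universal property of the Hecke algebra -/

section Lift

variable {R : Type*} [Ring R] [Algebra A R] (f : Fin 3 → R)
  (hq : ∀ i, f i * f i = 1 + xi i • f i) (hb : BraidRel f)

include hq hb in
theorem heckeRel_lift ⦃x y : FreeAlgebra A (Fin 3)⦄ (h : HeckeRel (typeB 3) (weightB 3) x y) :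
    FreeAlgebra.lift A f x = FreeAlgebra.lift A f y := by
  cases h with
  | quadratic i =>
    have := hq i
    rw [xi] at this
    simpa using this
  | braid i j => 
    rw [map_list_prod, map_list_prod, List.map_map, List.map_map]
    have e : (⇑(FreeAlgebra.lift A f) ∘ FreeAlgebra.ι A) = f := by ext; simp
    have := hb.braidWord i j
    rw [← e] at this
    exact this

/-- The homomorphism from the Hecke algebra defined by the images of the generators. -/
def heckeLift : HB 3 →ₐ[A] R :=
  show RingQuot (HeckeRel (typeB 3) (weightB 3)) →ₐ[A] R from
  RingQuot.liftAlgHom A ⟨FreeAlgebra.lift A f, heckeRel_lift f hq hb⟩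

theorem heckeLift_gB (i : Fin 3) : heckeLift f hq hb (gB i) = f i :=
  (RingQuot.liftAlgHom_mkAlgHom_apply A _ (heckeRel_lift f hq hb) _).trans (FreeAlgebra.lift_ι_apply f i)

end Lift

/-! ### The regular representation -/

/-- Left multiplication by a generator, in coordinates with respect to the basis `(T_w)`. -/
def opL (i : Fin 3) : Module.End A (Fin 48 → A) where
  toFun a k := a (lm i k) + if lm i k < k then xi i * a k else 0
  map_add' a b := by
    ext1 k; simp only [Pi.add_apply]; split_ifs <;> ring
  map_smul' c a := by
    ext1 k; simp only [Pi.smul_apply, smul_eq_mul, RingHom.id_apply]; split_ifs <;> ring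

/-- Right multiplication by a generator, in coordinates with respect to the basis `(T_w)`. -/
def opR (i : Fin 3) : Module.End A (Fin 48 → A) where
  toFun a k := a (rm i k) + if rm i k < k then xi i * a k else 0
  map_add' a b := by
    ext1 k; simp only [Pi.add_apply]; split_ifs <;> ring
  map_smul' c a := by
    ext1 k; simp only [Pi.smul_apply, smul_eq_mul, RingHom.id_apply]; split_ifs <;> ring

theorem opL_apply (i a k) : opL i a k = a (lm i k) + if lm i k < k then xi i * a k else 0 := rfl

theorem opR_apply (i a k) : opR i a k = a (rm i k) + if rm i k < k then xi i * a k else 0 := rfl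

/-- If s_i w = w s_j, the correction terms agree because the parameters do; otherwise the two
descent conditions are independent. -/
theorem opL_opR (i j : Fin 3) : Commute (opL i) (opR j) := by
  refine LinearMap.ext fun a => funext fun k => ?_
  change opL i (opR j a) k = opR j (opL i a) k
  simp only [opL_apply, opR_apply]
  rcases lm_rm_cases i j k with ⟨h1, h2, h3⟩ | ⟨h1, h2, h3⟩
  · have e1 : rm j (lm i k) = k := by rw [h1, rm_rm]
    have e2 : lm i (rm j k) = k := by rw [← h1, lm_lm]
    rw [e1, e2, xi_congr h2, h1]
  · rw [lm_rm] at h2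
    simp only [h2, h3, lm_rm]
    split_ifs <;> ring

theorem opL_opL (i : Fin 3) : opL i * opL i = 1 + xi i • opL i := by
  refine LinearMap.ext fun a => funext fun k => ?_
  change opL i (opL i a) k = a k + xi i * opL i a k
  simp only [opL_apply, lm_lm]
  by_cases h : lm i k < k
  · simp only [h, if_true, if_neg (lt_asymm h)]; ring
  · simp only [h, if_false, if_pos ((lt_lm_iff i k).2 h)]; ring

theorem opL_single (i : Fin 3) {k : Fin 48} (h : k < lm i k) :
    opL i (Pi.single k 1) = Pi.single (lm i k) 1 := by
  ext1 y
  rw [opL_apply]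
  by_cases hy : y = k
  · subst hy
    rw [if_neg (lt_asymm h), Pi.single_eq_of_ne h.ne', Pi.single_eq_of_ne h.ne, add_zero]
  · have e : (Pi.single (lm i k) 1 : Fin 48 → A) y = (Pi.single k 1 : Fin 48 → A) (lm i y) := by
      by_cases h2 : y = lm i k
      · subst h2; rw [lm_lm]; simp
      · rw [Pi.single_eq_of_ne h2, Pi.single_eq_of_ne]
        rintro rfl; exact h2 (lm_lm i y).symm
    rw [Pi.single_eq_of_ne hy, mul_zero, ite_self, add_zero, e]

theorem opR_single (i : Fin 3) {k : Fin 48} (h : k < rm i k) :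
    opR i (Pi.single k 1) = Pi.single (rm i k) 1 := by
  ext1 y
  rw [opR_apply]
  by_cases hy : y = k
  · subst hy
    rw [if_neg (lt_asymm h), Pi.single_eq_of_ne h.ne', Pi.single_eq_of_ne h.ne, add_zero]
  · have e : (Pi.single (rm i k) 1 : Fin 48 → A) y = (Pi.single k 1 : Fin 48 → A) (rm i y) := by
      by_cases h2 : y = rm i k
      · subst h2; rw [rm_rm]; simp
      · rw [Pi.single_eq_of_ne h2, Pi.single_eq_of_ne]
        rintro rfl; exact h2 (rm_rm i y).symm
    rw [Pi.single_eq_of_ne hy, mul_zero, ite_self, add_zero, e]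

/-- The right operators generate every basis vector from that of the identity, so an endomorphism
commuting with them is determined by its value there. -/
theorem end_eq_of_commute {X Y : Module.End A (Fin 48 → A)} (hX : ∀ j, Commute X (opR j))
    (hY : ∀ j, Commute Y (opR j)) (h : X (Pi.single 0 1) = Y (Pi.single 0 1)) : X = Y := by
  refine (Pi.basisFun A (Fin 48)).ext fun k => ?_
  rw [Pi.basisFun_apply]
  induction k using WellFoundedLT.induction with
  | ind k ih =>
    by_cases hk : k = 0
    · rw [hk, h]
    · obtain ⟨j, hj⟩ := exists_rm_lt k hk
      have e := opR_single j (k := rm j k) (by rwa [rm_rm])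
      rw [rm_rm] at e
      rw [← e]
      exact (LinearMap.congr_fun (hX j) _).trans
        ((congrArg (opR j) (ih _ hj)).trans (LinearMap.congr_fun (hY j) _).symm)

theorem foldr_opL_single (ω : List (Fin 3)) (h : len (ω.foldr lm 0) = ω.length) :
    ((ω.map opL).prod) (Pi.single 0 1) = Pi.single (ω.foldr lm 0) 1 := by
  induction ω with
  | nil => rfl
  | cons i ω ih =>
    rw [List.foldr_cons, List.length_cons] at h
    have h1 := len_foldr_le ω
    have h2 := len_lm i (ω.foldr lm 0)
    rw [List.map_cons, List.prod_cons, Module.End.mul_apply, ih (by omega), List.foldr_cons,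
      opL_single]
    omega

/-- Both sides commute with the right operators, so it suffices to compare them on the vector of the
identity. There the lengths add up and both sides give the vector of the same group element. -/
theorem braidRel_opL : BraidRel opL := by
  refine braidRel_of_braidWord fun i j => end_eq_of_commute ?_ ?_ ?_
  · intro k
    refine (Commute.list_prod_right _ _ fun x hx => ?_).symm
    obtain ⟨l, -, rfl⟩ := List.mem_map.1 hx
    exact (opL_opR l k).symm
  · intro k
    refine (Commute.list_prod_right _ _ fun x hx => ?_).symm
    obtain ⟨l, -, rfl⟩ := List.mem_map.1 hx
    exact (opL_opR l k).symm
  · have h : ∀ i j, len ((braidWord (typeB 3) i j).foldr lm 0) = (braidWord (typeB 3) i j).length ∧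
        (braidWord (typeB 3) i j).foldr lm 0 = (braidWord (typeB 3) j i).foldr lm 0 := by
      decide +kernel
    rw [foldr_opL_single _ (h i j).1, foldr_opL_single _ (h j i).1, (h i j).2]

/-- The regular representation. -/
def regRep : HB 3 →ₐ[A] Module.End A (Fin 48 → A) := heckeLift opL opL_opL braidRel_opL

/-! ### The standard basis -/

/-- The standard basis element with a given number. -/
def tB (k : Fin 48) : HB 3 := wordVal gB k

theorem tB_zero : tB 0 = 1 := wordVal_zero _

theorem gB_mul_tB_of_lt {i : Fin 3} {k : Fin 48} (h : k < lm i k) : gB i * tB k = tB (lm i k) :=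
  mul_wordVal braidRel_gB k i h

theorem gB_mul_tB (i : Fin 3) (k : Fin 48) :
    gB i * tB k = tB (lm i k) + if lm i k < k then xi i • tB k else 0 := by
  split_ifs with h
  · have e : tB k = gB i * tB (lm i k) := wordVal_eq_mul braidRel_gB h
    conv_lhs => rw [e]
    rw [← mul_assoc, gB_mul_gB, add_mul, one_mul, smul_mul_assoc, ← e]
  · rw [gB_mul_tB_of_lt ((lt_lm_iff i k).2 h), add_zero]

theorem regRep_tB (k : Fin 48) : regRep (tB k) (Pi.single 0 1) = Pi.single k 1 := by
  induction k using WellFoundedLT.induction with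
  | ind k ih =>
    by_cases hk : k = 0
    · subst hk; rw [tB_zero, map_one]; rfl
    · have h := lm_hd_lt k hk
      have h' : lm (hd k) k < lm (hd k) (lm (hd k) k) := by rwa [lm_lm]
      have e := gB_mul_tB_of_lt h'
      rw [lm_lm] at e
      rw [← e, map_mul, Module.End.mul_apply, ih _ h, regRep, heckeLift_gB, opL_single _ h', lm_lm]

/-- Evaluation of the regular representation at the vector of the identity sends T_w to a coordinate
vector. -/
theorem linearIndependent_tB : LinearIndependent A tB := by
  let φ : HB 3 →ₗ[A] (Fin 48 → A) :=
    (LinearMap.applyₗ (Pi.single 0 1 : Fin 48 → A)).comp regRep.toLinearMap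
  refine LinearIndependent.of_comp φ ?_
  have e : φ ∘ tB = Pi.basisFun A (Fin 48) := by
    ext1 k
    rw [Pi.basisFun_apply]
    exact regRep_tB k
  rw [e]
  exact (Pi.basisFun A (Fin 48)).linearIndependent

/-- An `A`-submodule of the Hecke algebra which is stable under the generators is a left ideal. -/
theorem mul_mem_of_gB_mul_mem {S : Submodule A (HB 3)} (hS : ∀ i, ∀ x ∈ S, gB i * x ∈ S)
    (h : HB 3) : ∀ x ∈ S, h * x ∈ S := by
  induction h using hecke_induction with
  | hA a => intro x hx; rw [← Algebra.smul_def]; exact S.smul_mem a hx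
  | hg i => exact hS i
  | hm x y hx hy => intro z hz; rw [mul_assoc]; exact hx _ (hy _ hz)
  | ha x y hx hy => intro z hz; rw [add_mul]; exact S.add_mem (hx _ hz) (hy _ hz)

theorem span_tB : Submodule.span A (Set.range tB) = ⊤ := by
  refine eq_top_iff.2 fun h _ => ?_
  rw [← mul_one h, ← tB_zero]
  refine mul_mem_of_gB_mul_mem (fun i x hx => ?_) h _ (Submodule.subset_span ⟨0, rfl⟩)
  induction hx using Submodule.span_induction with
  | mem x hx =>
    obtain ⟨k, rfl⟩ := hx
    rw [gB_mul_tB]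
    refine Submodule.add_mem _ (Submodule.subset_span ⟨_, rfl⟩) ?_
    split_ifs
    · exact Submodule.smul_mem _ _ (Submodule.subset_span ⟨_, rfl⟩)
    · exact Submodule.zero_mem _
  | zero => rw [mul_zero]; exact Submodule.zero_mem _
  | add x y _ _ hx hy => rw [mul_add]; exact Submodule.add_mem _ hx hy
  | smul a x _ hx => rw [mul_smul_comm]; exact Submodule.smul_mem _ _ hx

/-- The basis `(T_w)` of the Hecke algebra. -/
def tBasis : Module.Basis (Fin 48) A (HB 3) :=
  Module.Basis.mk linearIndependent_tB span_tB.ge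

theorem tBasis_apply (k : Fin 48) : tBasis k = tB k := Module.Basis.mk_apply _ _ k

theorem T_eq_tB (w : WB 3) : T (typeB 3) (weightB 3) w = tB (idx w) := by
  have h := Classical.choose_spec ((typeB 3).toCoxeterSystem.exists_isReduced w)
  have h2 := prod_map_of_isReduced braidRel_gB h.1
  rw [← h.2] at h2
  exact h2

/-! ### The bar involution -/

/-- The involution `ε^γ ↦ ε^(-γ)` of `A`. -/
def barA : A →+* A := AddMonoidAlgebra.mapDomainRingHom ℤ (negAddMonoidHom : ℤ × ℤ →+ ℤ × ℤ)

theorem barA_single (γ : ℤ × ℤ) (c : ℤ) :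
    barA (AddMonoidAlgebra.single γ c) = AddMonoidAlgebra.single (-γ) c := by
  simp [barA, AddMonoidAlgebra.mapDomain_single]

theorem barA_eps (γ : ℤ × ℤ) : barA (eps γ) = eps (-γ) := barA_single γ 1

theorem barA_xi (i : Fin 3) : barA (xi i) = -xi i := by
  rw [xi, map_sub, barA_eps, barA_eps, neg_neg, neg_sub]

/-- The Hecke algebra with the scalar action twisted by `barA`. -/
def TwistedHecke : Type := HB 3

instance : Ring TwistedHecke := inferInstanceAs (Ring (HB 3))

/-- The universal property yields A-linear homomorphisms only. The bar involution is semilinear, and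
becomes A-linear when the scalars of its target are twisted. -/
instance : Algebra A TwistedHecke :=
  ((algebraMap A (HB 3)).comp barA).toAlgebra' fun c x => Algebra.commutes (barA c) (show HB 3 from x)

theorem TwistedHecke.smul_def (a : A) (x : TwistedHecke) :
    a • x = (show TwistedHecke from barA a • (show HB 3 from x)) := by
  rw [Algebra.smul_def]
  exact (Algebra.smul_def (barA a) (show HB 3 from x)).symm

/-- The inverse of a generator. -/
def gInv (i : Fin 3) : HB 3 := gB i - algebraMap A (HB 3) (xi i)

theorem gInv_mul_gB (i : Fin 3) : gInv i * gB i = 1 := by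
  rw [gInv, sub_mul, gB_mul_gB, ← Algebra.smul_def, add_sub_cancel_right]

theorem gB_mul_gInv (i : Fin 3) : gB i * gInv i = 1 := by
  rw [gInv, mul_sub, gB_mul_gB, ← Algebra.commutes, ← Algebra.smul_def, add_sub_cancel_right]

theorem gInv_mul_gInv (i : Fin 3) : gInv i * gInv i = 1 - xi i • gInv i := by
  have h : gInv i * gInv i = gB i * gInv i - algebraMap A (HB 3) (xi i) * gInv i := by
    rw [← sub_mul]; rfl
  rw [h, gB_mul_gInv, Algebra.smul_def]

theorem braidRel_gInv : BraidRel gInv := by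
  let u (i : Fin 3) : (HB 3)ˣ := ⟨gB i, gInv i, gB_mul_gInv i, gInv_mul_gB i⟩
  have h := braidRel_gB
  have hu : BraidRel u :=
    ⟨Units.ext h.four, Units.ext h.three, Units.ext h.two⟩
  have e : ∀ i, gInv i = ((u i)⁻¹ : (HB 3)ˣ) := fun i => rfl
  constructor
  · simp only [e, ← Units.val_mul, ← mul_inv_rev]
    congr 2
    simpa [mul_assoc] using hu.four.symm
  · simp only [e, ← Units.val_mul, ← mul_inv_rev]
    congr 2
    simpa [mul_assoc] using hu.three
  · simp only [e, ← Units.val_mul, ← mul_inv_rev]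
    congr 2
    exact hu.two.symm

/-- The inverses of the generators as elements of the twisted algebra. -/
def gInvT (i : Fin 3) : TwistedHecke := gInv i

theorem gInvT_mul_gInvT (i : Fin 3) : gInvT i * gInvT i = 1 + xi i • gInvT i := by
  rw [TwistedHecke.smul_def, barA_xi]
  change gInv i * gInv i = 1 + -xi i • gInv i
  rw [gInv_mul_gInv, neg_smul, sub_eq_add_neg]

/-- The bar involution, as a homomorphism to the twisted algebra. -/
def barT : HB 3 →ₐ[A] TwistedHecke :=
  heckeLift gInvT gInvT_mul_gInvT
    ⟨braidRel_gInv.four, braidRel_gInv.three, braidRel_gInv.two⟩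

/-- The bar involution. -/
def barH : HB 3 →+* HB 3 := barT.toRingHom

theorem barH_gB (i : Fin 3) : barH (gB i) = gInv i := heckeLift_gB gInvT _ _ i

theorem barH_algebraMap (a : A) : barH (algebraMap A (HB 3) a) = algebraMap A (HB 3) (barA a) :=
  barT.commutes a

theorem barH_smul (a : A) (x : HB 3) : barH (a • x) = barA a • barH x := by
  rw [Algebra.smul_def, map_mul, barH_algebraMap, ← Algebra.smul_def]

/-- The ring is generated by the ε^γ and the T_s, so the involution in the definition is unique, and
`barH` is one. -/
theorem isSelfDual_iff (h : HB 3) : IsSelfDual (typeB 3) (weightB 3) h ↔ barH h = h := by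
  constructor
  · rintro ⟨bar, h1, h2, h3⟩
    have e : ∀ x, barH x = bar x := by
      intro x
      induction x using hecke_induction with
      | hA a =>
        rw [barH_algebraMap]
        induction a using AddMonoidAlgebra.induction_linear with
        | zero => simp
        | add x y hx hy => rw [map_add, map_add, map_add, map_add, hx, hy]
        | single γ c =>
          have e : AddMonoidAlgebra.single γ c = c • (eps γ : A) := by
            simp [eps, AddMonoidAlgebra.smul_single]
          rw [e, map_zsmul, map_zsmul, map_zsmul, map_zsmul, h1, barA_eps]
      | hg i => rw [barH_gB]; exact (left_inv_eq_right_inv (h2 i).1 (gB_mul_gInv i)).symm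
      | hm x y hx hy => rw [map_mul, map_mul, hx, hy]
      | ha x y hx hy => rw [map_add, map_add, hx, hy]
    rw [e, h3]
  · intro h1
    exact ⟨barH, fun γ => by rw [barH_algebraMap, barA_eps],
      fun i => by rw [barH_gB]; exact ⟨gInv_mul_gB i, gB_mul_gInv i⟩, h1⟩

/-! ## Laurent polynomials as lists -/

/-- Laurent polynomials in `V` and `v` as lists of terms: `(i, j, c)` stands for `c V^i v^j`. -/
abbrev LPoly : Type := List (ℤ × ℤ × ℤ)

/-- The Laurent polynomial given by a list of terms. -/
def toA (p : LPoly) : A := (p.map fun t => AddMonoidAlgebra.single (t.1, t.2.1) t.2.2).sum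

theorem toA_nil : toA [] = 0 := rfl

theorem toA_cons (t : ℤ × ℤ × ℤ) (p : LPoly) :
    toA (t :: p) = AddMonoidAlgebra.single (t.1, t.2.1) t.2.2 + toA p := by simp [toA]

theorem toA_append (p q : LPoly) : toA (p ++ q) = toA p + toA q := by simp [toA]

theorem coeff_toA_ne_zero {p : LPoly} {γ : ℤ × ℤ} (h : (toA p).coeff γ ≠ 0) :
    ∃ t ∈ p, (t.1, t.2.1) = γ := by
  induction p with
  | nil => simp [toA_nil] at h
  | cons t p ih =>
    by_cases ht : (t.1, t.2.1) = γ
    · exact ⟨t, List.mem_cons_self, ht⟩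
    · rw [toA_cons, AddMonoidAlgebra.coeff_add, Finsupp.add_apply, AddMonoidAlgebra.coeff_single,
        Finsupp.single_eq_of_ne (Ne.symm ht), zero_add] at h
      obtain ⟨u, hu, hu'⟩ := ih h
      exact ⟨u, List.mem_cons_of_mem _ hu, hu'⟩

/-- A list of terms whose first term does not cancel. -/
def headSurvives : LPoly → Bool
  | [] => false
  | t :: p => t.2.2 ≠ 0 && p.all fun u => u.1 ≠ t.1 || u.2.1 ≠ t.2.1

theorem toA_ne_zero {p : LPoly} (h : headSurvives p = true) : toA p ≠ 0 := by
  cases p with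
  | nil => simp [headSurvives] at h
  | cons t p =>
    simp only [headSurvives, ne_eq, decide_not, Bool.and_eq_true, Bool.not_eq_eq_eq_not,
      Bool.not_true, decide_eq_false_iff_not, List.all_eq_true, Bool.or_eq_true] at h
    intro h0
    have h1 := congrArg (fun a : A => a.coeff (t.1, t.2.1)) h0
    have h2 : (toA p).coeff (t.1, t.2.1) = 0 := by
      by_contra h2
      obtain ⟨u, hu, hu'⟩ := coeff_toA_ne_zero h2
      rw [Prod.mk.injEq] at hu'
      exact (h.2 u hu).elim (fun h => h hu'.1) (fun h => h hu'.2)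
    simp only [toA_cons, AddMonoidAlgebra.coeff_add, Finsupp.add_apply,
      AddMonoidAlgebra.coeff_single, Finsupp.single_eq_same, h2, add_zero] at h1
    exact h.1 h1

/-- Adds the term `c V^i v^j`. -/
def addTerm (i j c : ℤ) (p : LPoly) : LPoly :=
  List.rec [(i, j, c)] (fun u p ih => Bool.rec (u :: ih) (Bool.rec (u :: ih)
    (Bool.rec ((i, j, c + u.2.2) :: p) p (Int.beq' (c + u.2.2) 0)) (Int.beq' j u.2.1))
    (Int.beq' i u.1)) p

/-- The recursors and `Int.beq'` in `addTerm` let the kernel evaluate it without unfolding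
decidability instances; the proof first passes to the equivalent form with `if`. -/
theorem toA_addTerm (i j c : ℤ) (p : LPoly) :
    toA (addTerm i j c p) = AddMonoidAlgebra.single (i, j) c + toA p := by
  induction p with
  | nil => rfl
  | cons u p ih =>
    have e : addTerm i j c (u :: p) = if i = u.1 then (if j = u.2.1 then
        (if c + u.2.2 = 0 then p else (i, j, c + u.2.2) :: p) else u :: addTerm i j c p)
        else u :: addTerm i j c p := by
      have h (a b : ℤ) (x y : LPoly) : (if a = b then x else y) =
          Bool.rec (motive := fun _ => LPoly) y x (Int.beq' a b) := by
        rw [Int.beq'_eq_beq]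
        by_cases h : a = b
        · simp [h]
        · rw [if_neg h, beq_false_of_ne h]
      simp only [h]
      rfl
    have e2 : toA (u :: addTerm i j c p) = AddMonoidAlgebra.single (i, j) c + toA (u :: p) := by
      rw [toA_cons, toA_cons, ih, add_left_comm]
    rw [e]
    split_ifs with h1 h2 h3
    · rw [toA_cons, h1, h2, ← add_assoc, ← AddMonoidAlgebra.single_add, h3,
        AddMonoidAlgebra.single_zero, zero_add]
    · rw [toA_cons, toA_cons, h1, h2, ← add_assoc, ← AddMonoidAlgebra.single_add]
    · exact e2
    · exact e2

/-- Computes `q + c V^a v^b p`. -/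
def addMul (a b c : ℤ) (p q : LPoly) : LPoly :=
  List.rec q (fun u _ ih => addTerm (a + u.1) (b + u.2.1) (c * u.2.2) ih) p

theorem toA_addMul (a b c : ℤ) (p q : LPoly) :
    toA (addMul a b c p q) = AddMonoidAlgebra.single (a, b) c * toA p + toA q := by
  induction p with
  | nil => rw [toA_nil, mul_zero, zero_add]; rfl
  | cons u p ih =>
    have e : addMul a b c (u :: p) q =
      addTerm (a + u.1) (b + u.2.1) (c * u.2.2) (addMul a b c p q) := rfl
    rw [e, toA_addTerm, ih, toA_cons, mul_add, AddMonoidAlgebra.single_mul_single, add_assoc]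
    rfl

/-- Computes `r - p q`. -/
def subMul (p q r : LPoly) : LPoly := p.foldr (fun t r => addMul t.1 t.2.1 (-t.2.2) q r) r

theorem toA_subMul (p q r : LPoly) : toA (subMul p q r) = toA r - toA p * toA q := by
  induction p with
  | nil => rw [toA_nil, zero_mul, sub_zero]; rfl
  | cons t p ih =>
    have e : subMul (t :: p) q r = addMul t.1 t.2.1 (-t.2.2) q (subMul p q r) := rfl
    rw [e, toA_addMul, ih, toA_cons, AddMonoidAlgebra.single_neg]
    ring

/-! ## Evaluation to normal form -/

section Force

variable {β : Type}

/-- Application to a natural number, which is evaluated first. -/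
def forceNat (n : ℕ) (k : ℕ → β) : β := Nat.rec (k 0) (fun m _ => k (m + 1)) n

/-- The recursor makes the kernel compute the argument before passing it on, so that no unevaluated
expression is copied. For proofs it is plain application, and so are the other functions built on
it. -/
theorem forceNat_eq (n : ℕ) (k : ℕ → β) : forceNat n k = k n := by cases n <;> rfl

/-- Application to an integer, which is evaluated first. -/
def forceInt (x : ℤ) (k : ℤ → β) : β :=
  Int.rec (fun n => forceNat n fun m => k (Int.ofNat m))
    (fun n => forceNat n fun m => k (Int.negSucc m)) x

theorem forceInt_eq (x : ℤ) (k : ℤ → β) : forceInt x k = k x := by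
  cases x with
  | ofNat n => exact forceNat_eq n fun m => k (Int.ofNat m)
  | negSucc n => exact forceNat_eq n fun m => k (Int.negSucc m)

/-- Application to a Laurent polynomial, which is evaluated first. -/
def forcePoly (p : LPoly) : (LPoly → β) → β :=
  List.rec (fun k => k []) (fun u _ ih k => forceInt u.1 fun a => forceInt u.2.1 fun b =>
    forceInt u.2.2 fun c => ih fun q => k ((a, b, c) :: q)) p

theorem forcePoly_eq (p : LPoly) (k : LPoly → β) : forcePoly p k = k p := by
  induction p generalizing k with
  | nil => rfl
  | cons u p ih =>
    have e : forcePoly (u :: p) k = forceInt u.1 fun a => forceInt u.2.1 fun b =>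
      forceInt u.2.2 fun c => forcePoly p fun q => k ((a, b, c) :: q) := rfl
    rw [e, forceInt_eq, forceInt_eq, forceInt_eq, ih]

end Force

/-! ## Coordinate vectors as binary trees -/

/-- Vectors of Laurent polynomials, as binary trees. -/
inductive LVec : Type
  | leaf (p : LPoly)
  | node (x y : LVec)

namespace LVec

/-- The entry number `n`. -/
def get (x : LVec) : ℕ → LPoly :=
  LVec.rec (fun p _ => p) (fun _ _ f g n => Bool.rec (g (n / 2)) (f (n / 2)) (Nat.beq (n % 2) 0)) x

/-- Application to the tree of depth `d` with prescribed entries, which are evaluated first. -/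
def build {β : Type} : ℕ → (ℕ → LPoly) → (LVec → β) → β
  | 0, f, k => forcePoly (f 0) fun p => k (leaf p)
  | d + 1, f, k => build d (fun n => f (2 * n)) fun x =>
      build d (fun n => f (2 * n + 1)) fun y => k (node x y)

/-- Proofs need only that the continuation is applied to some fixed tree. All that is ever used
about its entries comes from the Boolean checks. -/
theorem exists_build_eq {β : Type} (d : ℕ) (f : ℕ → LPoly) :
    ∃ x : LVec, ∀ k : LVec → β, build d f k = k x := by
  induction d generalizing f with
  | zero => exact ⟨leaf (f 0), fun k => forcePoly_eq _ _⟩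
  | succ d ih =>
    obtain ⟨x, hx⟩ := ih fun n => f (2 * n)
    obtain ⟨y, hy⟩ := ih fun n => f (2 * n + 1)
    exact ⟨node x y, fun k => by rw [build, hx, hy]⟩

end LVec

/-- The entry number `y` of the vector number `k` in a list. -/
def tabEntry (t : List LVec) (k y : Fin 48) : LPoly := (t.getD k (.leaf [])).get y

/-- A copy of `weightB 3` without the passage to ℕ, for evaluation. -/
def wtC (i : Fin 3) : ℤ × ℤ := if i = 0 then (1, 0) else (0, 1)

theorem weightB_eq (i : Fin 3) : weightB 3 i = wtC i := by revert i; decide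

/-- Computes the sum of `q` and the coordinate number `y` of the product of `T_i` and the element
with the coordinates `f`. -/
def actAdd (i : Fin 3) (f : Fin 48 → LPoly) (y : Fin 48) (q : LPoly) : LPoly :=
  addMul 0 0 1 (f (lm i y)) (if lm i y < y then
    addMul (wtC i).1 (wtC i).2 1 (f y) (addMul (-(wtC i).1) (-(wtC i).2) (-1) (f y) q) else q)

theorem toA_actAdd (i : Fin 3) (f : Fin 48 → LPoly) (y : Fin 48) (q : LPoly) :
    toA (actAdd i f y q) = toA (f (lm i y)) + (if lm i y < y then xi i * toA (f y) else 0) + toA q := by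
  have e1 : AddMonoidAlgebra.single ((0, 0) : ℤ × ℤ) (1 : ℤ) = (1 : A) := rfl
  have e2 : xi i = AddMonoidAlgebra.single ((wtC i).1, (wtC i).2) 1 +
      AddMonoidAlgebra.single (-(wtC i).1, -(wtC i).2) (-1) := by
    rw [xi, weightB_eq, AddMonoidAlgebra.single_neg, ← sub_eq_add_neg]; rfl
  rw [actAdd, toA_addMul, e1, one_mul, e2]
  split_ifs
  · rw [toA_addMul, toA_addMul]; ring
  · rw [add_zero]

/-! ## W-graphs -/

/-- The entries `(i, k, z, c, a, b)` of a table stand for the coefficients of `C_z` in the product of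
`C_i` and `C_k`, where the `i`-th generator is not a left descent of the element `k`: the coefficient
is `c` if `a = b = 0` and `c (V^a v^b + V^(-a) v^(-b))` otherwise. The coefficients `1` of the product
of the generator and the element `k` are omitted. -/
abbrev MuTable : Type := List (Fin 3 × Fin 48 × Fin 48 × ℤ × ℤ × ℤ)

/-- The entries that are common to the two orders. -/
def muCommon : MuTable :=
  [(0, 6, 1, 1, 1, -1), (0, 12, 4, 1, 1, -1), (0, 13, 5, 1, 1, -1), (0, 15, 5, 1, 1, -1),
    (0, 20, 10, 1, 1, -1), (0, 21, 11, 1, 1, -1), (0, 23, 11, 1, 1, -1), (0, 28, 18, 1, 1, -1),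
    (0, 29, 16, 1, 1, -1), (0, 29, 19, 1, 1, -1), (0, 31, 5, 1, 1, -1), (0, 31, 18, 1, 1, -1),
    (0, 36, 24, 1, 1, -1), (0, 36, 26, 1, 1, -1), (0, 37, 27, 1, 1, -1), (0, 42, 16, 1, 1, -1),
    (0, 42, 32, 1, 1, -1), (0, 42, 34, 1, 1, -1), (0, 43, 35, 1, 1, -1), (0, 46, 41, 1, 1, -1),
    (1, 8, 2, 1, 0, 0), (1, 15, 6, 1, 0, 0), (1, 23, 12, 1, 0, 0), (1, 25, 16, 1, 0, 0),
    (1, 27, 16, 1, 0, 0), (1, 31, 20, 1, 0, 0), (1, 31, 22, 1, 0, 0), (1, 35, 24, 1, 0, 0),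
    (1, 41, 32, 1, 0, 0), (1, 45, 39, 1, 0, 0), (2, 7, 3, 1, 0, 0), (2, 10, 5, 1, 0, 0),
    (2, 13, 5, 1, 0, 0), (2, 21, 11, 1, 0, 0), (2, 28, 18, 1, 0, 0), (2, 29, 19, 1, 0, 0),
    (2, 36, 26, 1, 0, 0), (2, 42, 34, 1, 0, 0), (2, 42, 37, 1, 0, 0), (2, 44, 40, 1, 0, 0)]

/-- The table for the lexicographic order. -/
def muAsym : MuTable := muCommon ++
  [(0, 22, 5, 1, 1, -2), (0, 29, 9, -1, 1, -2), (0, 30, 11, 1, 1, -2), (0, 36, 17, -1, 1, -2),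
    (0, 38, 18, 1, 1, -2), (0, 42, 25, -1, 1, -2)]

/-- The table for the weighted lexicographic order. -/
def muWeighted : MuTable := muCommon ++
  [(1, 31, 14, 1, 1, -2), (1, 33, 16, -1, 1, -2), (2, 17, 5, -1, 1, -2), (2, 25, 11, -1, 1, -2),
    (2, 28, 14, 1, 1, -2), (2, 33, 19, -1, 1, -2), (2, 36, 22, 1, 1, -2), (2, 42, 30, 1, 1, -2)]

/-- The Laurent polynomial of an entry of a table. -/
def symm (c a b : ℤ) : LPoly := if a = 0 ∧ b = 0 then [(0, 0, c)] else [(a, b, c), (-a, -b, c)]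

/-- The part of a table that concerns the product of `C_i` and `C_k`. -/
def mus (m : MuTable) (i : Fin 3) (k : Fin 48) : List (Fin 48 × LPoly) :=
  m.filterMap fun e => if e.1 = i ∧ e.2.1 = k then
    some (e.2.2.1, symm e.2.2.2.1 e.2.2.2.2.1 e.2.2.2.2.2) else none

/-- The coefficients of `T_i C_k` in the Kazhdan-Lusztig basis. -/
def col (m : MuTable) (i : Fin 3) (k : Fin 48) : List (Fin 48 × LPoly) :=
  if lm i k < k then [(k, [((wtC i).1, (wtC i).2, 1)])]
  else (lm i k, [(0, 0, 1)]) :: (k, [(-(wtC i).1, -(wtC i).2, -1)]) :: mus m i k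

/-- The coefficient with the number `z` in a list of coefficients. -/
def entry (l : List (Fin 48 × LPoly)) (z : Fin 48) : LPoly :=
  l.foldr (fun e r => if e.1 = z then e.2 ++ r else r) []

theorem sum_entry_smul {X : Type*} [AddCommGroup X] [Module A X] (l : List (Fin 48 × LPoly))
    (c : Fin 48 → X) :
    ∑ z, toA (entry l z) • c z = (l.map fun e => toA e.2 • c e.1).sum := by
  induction l with
  | nil => simp [entry, toA_nil]
  | cons e l ih =>
    have h : ∀ z, toA (entry (e :: l) z) • c z =
        (if e.1 = z then toA e.2 • c z else 0) + toA (entry l z) • c z := by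
      intro z
      have h : entry (e :: l) z = if e.1 = z then e.2 ++ entry l z else entry l z := rfl
      rw [h]
      split_ifs
      · rw [toA_append, add_smul]
      · rw [zero_add]
    rw [Finset.sum_congr rfl fun z _ => h z, Finset.sum_add_distrib, ih, List.map_cons,
      List.sum_cons, Finset.sum_ite_eq]
    simp

/-- Application to the vector of coordinates of the Kazhdan-Lusztig basis element number `k`, where
the list `t` gives the coordinates of the elements with smaller numbers. -/
def withNext {β : Type} (m : MuTable) (t : List LVec) (k : Fin 48) : (LVec → β) → β :=
  let i := hd k
  let k' := lm i k
  let x := t.getD k' (.leaf [])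
  -- With k' = s_i k, the recursion is C_k = T_i C_{k'} + v_i⁻¹ C_{k'} - ∑ μ_z C_z; `ms` collects
  -- what is subtracted from T_i C_{k'}.
  let ms := (k', [(-(wtC i).1, -(wtC i).2, -1)]) :: mus m i k'
  -- Depth 6 gives 64 leaves. Those from number 48 on repeat earlier entries and are never read.
  LVec.build 6 fun n => actAdd i (fun y => x.get y) (Fin.ofNat 48 n)
    (ms.foldr (fun e r => subMul e.2 (tabEntry t e.1 (Fin.ofNat 48 n)) r) [])

/-- Application to the list of the coordinates of the Kazhdan-Lusztig basis elements with numbers up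
to `n`. -/
def withTab {β : Type} (m : MuTable) : ℕ → (List LVec → β) → β
  | 0, k => LVec.build 6 (fun n => if n = 0 then [(0, 0, 1)] else []) fun x => k [x]
  | n + 1, k => withTab m n fun t => withNext m t (Fin.ofNat 48 (n + 1)) fun x => k (t ++ [x])

theorem exists_withTab_eq {β : Type} (m : MuTable) (n : ℕ) :
    ∃ t : List LVec, ∀ k : List LVec → β, withTab m n k = k t := by
  induction n with
  | zero =>
    obtain ⟨x, hx⟩ := LVec.exists_build_eq (β := β) 6 fun n => if n = 0 then [(0, 0, 1)] else []
    exact ⟨[x], fun k => hx _⟩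
  | succ n ih =>
    obtain ⟨t, ht⟩ := ih
    obtain ⟨x, hx⟩ : ∃ x : LVec, ∀ k : LVec → β, withNext m t (Fin.ofNat 48 (n + 1)) k = k x := by
      unfold withNext
      exact LVec.exists_build_eq 6 _
    exact ⟨t ++ [x], fun k => by rw [withTab, ht, hx]⟩

/-- Checks that the given elements are unitriangular with negative coefficients. -/
def checkUnitriangular (neg : ℤ → ℤ → Bool) (t : List LVec) : Bool :=
  (List.finRange 48).all fun k => (List.finRange 48).all fun y =>
    if y = k then tabEntry t k y = [(0, 0, 1)]
    else if k < y then tabEntry t k y = [] else (tabEntry t k y).all fun u => neg u.1 u.2.1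

/-- Checks the products of the generators and the given elements. -/
def checkProducts (m : MuTable) (t : List LVec) : Bool :=
  (List.finRange 3).all fun i => (List.finRange 48).all fun k =>
    let l := col m i k
    let x := t.getD k (.leaf [])
    (List.finRange 48).all fun y => (actAdd i (fun y => x.get y) y
      (l.foldr (fun e r => subMul e.2 (tabEntry t e.1 y) r) [])).isEmpty

/-- Checks that the entries of a table occur for smaller elements only and have non-zero values. -/
def checkMu (m : MuTable) : Bool :=
  (List.finRange 3).all fun i => (List.finRange 48).all fun k =>
    (mus m i k).all fun e => e.1 < k

def negAsym (a b : ℤ) : Bool := a < 0 || (a = 0 && b < 0)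
def negWeighted (a b : ℤ) : Bool := a + b < 0 || (a + b = 0 && a < 0)

/-- All checks for a table. -/
def checkAll (neg : ℤ → ℤ → Bool) (m : MuTable) : Bool :=
  checkMu m && withTab m 47 fun t => checkUnitriangular neg t && checkProducts m t

/-- Passing the checks proves a table correct, by the uniqueness of the Kazhdan–Lusztig basis; the
origin of its entries plays no role. -/
theorem checkAll_asym : checkAll negAsym muAsym = true := by decide +kernel

theorem checkAll_weighted : checkAll negWeighted muWeighted = true := by decide +kernel

/-! ## Uniqueness of the Kazhdan-Lusztig basis -/

/-- The span of the standard basis elements of length less than `n`. -/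
def lenFilt (n : ℕ) : Submodule A (HB 3) := Submodule.span A (tB '' {k | len k < n})

theorem tB_mem_lenFilt {k : Fin 48} {n : ℕ} (h : len k < n) : tB k ∈ lenFilt n :=
  Submodule.subset_span ⟨k, h, rfl⟩

theorem gB_mul_mem_lenFilt (i : Fin 3) {n : ℕ} {x : HB 3} (hx : x ∈ lenFilt n) :
    gB i * x ∈ lenFilt (n + 1) := by
  induction hx using Submodule.span_induction with
  | mem x hx =>
    obtain ⟨k, hk, rfl⟩ := hx
    have hk' : len k < n := hk
    have h := len_lm i k
    rw [gB_mul_tB]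
    refine Submodule.add_mem _ (tB_mem_lenFilt (by omega)) ?_
    split_ifs
    · exact Submodule.smul_mem _ _ (tB_mem_lenFilt (by omega))
    · exact Submodule.zero_mem _
  | zero => rw [mul_zero]; exact Submodule.zero_mem _
  | add x y _ _ hx hy => rw [mul_add]; exact Submodule.add_mem _ hx hy
  | smul a x _ hx => rw [mul_smul_comm]; exact Submodule.smul_mem _ _ hx

theorem lenFilt_mono {m n : ℕ} (h : m ≤ n) : lenFilt m ≤ lenFilt n :=
  Submodule.span_mono (Set.image_mono fun _ hk => lt_of_lt_of_le hk h)

/-- Since bar(T_i) = T_i - ξ_i, the bar involution fixes T_w up to shorter elements, by induction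
along a reduced expression. -/
theorem barH_tB (k : Fin 48) : barH (tB k) - tB k ∈ lenFilt (len k) := by
  induction k using WellFoundedLT.induction with
  | ind k ih =>
    by_cases hk : k = 0
    · subst hk; rw [tB_zero, map_one, sub_self]; exact Submodule.zero_mem _
    · have h := lm_hd_lt k hk
      set i := hd k
      have e : tB k = gB i * tB (lm i k) := by
        rw [gB_mul_tB_of_lt (by rwa [lm_lm]), lm_lm]
      have hl : len k = len (lm i k) + 1 := by
        rcases len_lm i k with h' | h'
        · exact absurd h (lt_asymm h'.2)
        · exact h'.1.symm
      have e2 : barH (tB k) - tB k = gB i * (barH (tB (lm i k)) - tB (lm i k)) -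
          xi i • (barH (tB (lm i k)) - tB (lm i k)) - xi i • tB (lm i k) := by
        conv_lhs => rw [e]
        rw [map_mul, barH_gB, gInv, sub_mul, ← Algebra.smul_def, mul_sub, smul_sub]
        abel
      rw [e2, hl]
      exact Submodule.sub_mem _ (Submodule.sub_mem _ (gB_mul_mem_lenFilt i (ih _ h))
        (Submodule.smul_mem _ _ (lenFilt_mono (Nat.le_succ _) (ih _ h))))
        (Submodule.smul_mem _ _ (tB_mem_lenFilt (Nat.lt_succ_self _)))

theorem coord_eq_zero_of_mem_lenFilt {y : Fin 48} {n : ℕ} (h : n ≤ len y) {x : HB 3}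
    (hx : x ∈ lenFilt n) : tBasis.coord y x = 0 := by
  induction hx using Submodule.span_induction with
  | mem x hx =>
    obtain ⟨k, hk, rfl⟩ := hx
    have hk' : len k < n := hk
    rw [← tBasis_apply, Module.Basis.coord_apply, Module.Basis.repr_self,
      Finsupp.single_eq_of_ne]
    rintro rfl
    omega
  | zero => exact map_zero _
  | add x y _ _ hx hy => rw [map_add, hx, hy, add_zero]
  | smul a x _ hx => rw [map_smul, hx, smul_zero]

theorem coord_tB (y k : Fin 48) : tBasis.coord y (tB k) = if k = y then 1 else 0 := by
  rw [← tBasis_apply, Module.Basis.coord_apply, Module.Basis.repr_self, Finsupp.single_apply]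

theorem coeff_barA (a : A) (γ : ℤ × ℤ) : (barA a).coeff (-γ) = a.coeff γ := by
  induction a using AddMonoidAlgebra.induction_linear with
  | zero => rw [map_zero]; rfl
  | add x y hx hy =>
    rw [map_add, AddMonoidAlgebra.coeff_add, AddMonoidAlgebra.coeff_add, Finsupp.add_apply,
      Finsupp.add_apply, hx, hy]
  | single m r =>
    rw [barA_single, AddMonoidAlgebra.coeff_single, AddMonoidAlgebra.coeff_single,
      Finsupp.single_apply, Finsupp.single_apply]
    simp only [neg_inj]

section Order

variable {lt : ℤ × ℤ → ℤ × ℤ → Prop}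

/-- The exponents of a bar-invariant Laurent polynomial come in pairs γ, -γ, which cannot both be
negative. -/
theorem eq_zero_of_isNegative (hlt : ∀ γ, lt γ 0 → ¬ lt (-γ) 0) {a : A} (ha : IsNegative lt a)
    (h : barA a = a) : a = 0 := by
  ext γ
  by_contra hγ
  refine hlt γ (ha γ hγ) (ha (-γ) ?_)
  rwa [← h, coeff_barA]

theorem isNegative_sub {a b : A} (ha : IsNegative lt a) (hb : IsNegative lt b) :
    IsNegative lt (a - b) := by
  intro γ h
  by_cases h1 : a.coeff γ = 0
  · refine hb γ fun h2 => h ?_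
    rw [AddMonoidAlgebra.coeff_sub, Finsupp.sub_apply, h1, h2, sub_zero]
  · exact ha γ h1

/-- Take y of maximal length among the elements with non-zero coefficient. By `barH_tB` no other
term contributes to the coefficient of T_y after applying bar, so this coefficient is both
bar-invariant and negative. -/
theorem eq_zero_of_barH_eq (hlt : ∀ γ, lt γ 0 → ¬ lt (-γ) 0) {a : Fin 48 → A}
    (ha : ∀ y, IsNegative lt (a y)) (h : barH (∑ y, a y • tB y) = ∑ y, a y • tB y) : a = 0 := by
  by_contra hne
  obtain ⟨y₁, hy₁⟩ := Function.ne_iff.1 hne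
  obtain ⟨y, hy, hmax⟩ := Finset.exists_max_image (Finset.univ.filter fun y => a y ≠ 0) len
    ⟨y₁, by simpa using hy₁⟩
  simp only [Finset.mem_filter, Finset.mem_univ, true_and] at hy hmax
  refine hy (eq_zero_of_isNegative hlt (ha y) ?_)
  have h1 := congrArg (tBasis.coord y) h
  rw [map_sum, map_sum, map_sum] at h1
  have e1 : ∀ z, tBasis.coord y (a z • tB z) = if z = y then a z else 0 := fun z => by
    rw [map_smul, coord_tB, smul_eq_mul, mul_ite, mul_one, mul_zero]
  have e2 : ∀ z, tBasis.coord y (barH (a z • tB z)) = if z = y then barA (a z) else 0 := by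
    intro z
    by_cases hz : a z = 0
    · rw [hz, zero_smul, map_zero, map_zero, map_zero, ite_self]
    · rw [barH_smul, map_smul, ← sub_add_cancel (barH (tB z)) (tB z), map_add,
        coord_eq_zero_of_mem_lenFilt (hmax z hz) (barH_tB z), coord_tB, zero_add, smul_eq_mul,
        mul_ite, mul_one, mul_zero]
  rw [Finset.sum_congr rfl fun z _ => e1 z, Finset.sum_congr rfl fun z _ => e2 z] at h1
  simpa using h1

theorem isKL_iff (w : WB 3) (c : HB 3) : IsKL (typeB 3) (weightB 3) lt w c ↔
    barH c = c ∧ ∃ a : Fin 48 → A, a (idx w) = 0 ∧ (∀ y, IsNegative lt (a y)) ∧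
      c = tB (idx w) + ∑ y, a y • tB y := by
  have : Fintype (WB 3) := Fintype.ofEquiv _ idxEquiv.symm
  rw [IsKL, isSelfDual_iff, T_eq_tB]
  have key : ∀ p : WB 3 →₀ A, (p.sum fun y a => a • T (typeB 3) (weightB 3) y) =
      ∑ y, p (elem y) • tB y := by
    intro p
    rw [Finsupp.sum_fintype p (fun y a => a • T (typeB 3) (weightB 3) y) fun y => zero_smul _ _,
      ← idxEquiv.symm.sum_comp]
    refine Finset.sum_congr rfl fun y _ => ?_
    rw [T_eq_tB]
    exact congrArg (fun z => p (elem y) • tB z) (idx_elem y)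
  refine and_congr_right fun _ => ⟨?_, ?_⟩
  · rintro ⟨p, h1, h2, h3⟩
    exact ⟨fun y => p (elem y), (congrArg p (elem_idx w)).trans h1, fun y => h2 _, by rw [h3, key]⟩
  · rintro ⟨a, h1, h2, h3⟩
    refine ⟨Finsupp.equivFunOnFinite.symm fun y => a (idx y), h1, fun y => h2 _, ?_⟩
    rw [h3, key]
    simp [idx_elem]

theorem isKL_unique (hlt : ∀ γ, lt γ 0 → ¬ lt (-γ) 0) {w : WB 3} {c d : HB 3}
    (hc : IsKL (typeB 3) (weightB 3) lt w c) (hd : IsKL (typeB 3) (weightB 3) lt w d) : c = d := by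
  obtain ⟨h1, a, -, ha, h2⟩ := (isKL_iff w c).1 hc
  obtain ⟨h3, b, -, hb, h4⟩ := (isKL_iff w d).1 hd
  have e : c - d = ∑ y, (a - b) y • tB y := by
    simp only [Pi.sub_apply, sub_smul, Finset.sum_sub_distrib]
    rw [h2, h4]
    abel
  have h0 : a - b = 0 := eq_zero_of_barH_eq hlt (fun y => isNegative_sub (ha y) (hb y))
    (by rw [← e, map_sub, h1, h3])
  rw [← sub_eq_zero, e, h0]
  simp

theorem C_eq (hlt : ∀ γ, lt γ 0 → ¬ lt (-γ) 0) {w : WB 3} {c : HB 3}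
    (hc : IsKL (typeB 3) (weightB 3) lt w c) : C (typeB 3) (weightB 3) lt w = c :=
  isKL_unique hlt (Classical.epsilon_spec (p := IsKL (typeB 3) (weightB 3) lt w) ⟨c, hc⟩) hc

end Order

/-! ## The Kazhdan-Lusztig basis of a table -/

/-- The elements with the coordinates in a list of vectors. -/
def tabElt (t : List LVec) (k : Fin 48) : HB 3 := ∑ y, toA (tabEntry t k y) • tB y

theorem gB_mul_sum (i : Fin 3) (a : Fin 48 → A) : gB i * ∑ y, a y • tB y =
    ∑ y, (a (lm i y) + if lm i y < y then xi i * a y else 0) • tB y := by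
  have e : ∑ y, a (lm i y) • tB y = ∑ y, a y • tB (lm i y) := by
    rw [← Equiv.sum_comp (Function.Involutive.toPerm (lm i) (lm_lm i)) fun y => a (lm i y) • tB y]
    refine Finset.sum_congr rfl fun y _ => ?_
    change a (lm i (lm i y)) • tB (lm i y) = _
    rw [lm_lm]
  simp only [add_smul, Finset.sum_add_distrib]
  rw [e, Finset.mul_sum, ← Finset.sum_add_distrib]
  refine Finset.sum_congr rfl fun y _ => ?_
  rw [mul_smul_comm, gB_mul_tB, smul_add]
  split_ifs
  · rw [smul_smul, mul_comm]
  · rw [smul_zero, zero_smul]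

theorem toA_one : toA [(0, 0, 1)] = 1 := by
  rw [toA_cons, toA_nil, add_zero]; rfl

section Table

variable {neg : ℤ → ℤ → Bool} {m : MuTable} {t : List LVec}

theorem checkUnitriangular_iff : checkUnitriangular neg t = true ↔
    ∀ k y, if y = k then tabEntry t k y = [(0, 0, 1)]
      else if k < y then tabEntry t k y = [] else ∀ u ∈ tabEntry t k y, neg u.1 u.2.1 = true := by
  simp only [checkUnitriangular, List.all_eq_true, List.mem_finRange, forall_const]
  refine forall_congr' fun k => forall_congr' fun y => ?_
  split_ifs
  · rw [decide_eq_true_iff]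
  · rw [decide_eq_true_iff]
  · rw [List.all_eq_true]

/-- The check computes the difference of the two sides in each coordinate and finds the empty list.
-/
theorem gB_mul_tabElt (h : checkProducts m t = true) (i : Fin 3) (k : Fin 48) :
    gB i * tabElt t k = ((col m i k).map fun e => toA e.2 • tabElt t e.1).sum := by
  simp only [checkProducts, List.all_eq_true, List.mem_finRange, forall_const,
    List.isEmpty_iff] at h
  have key : ∀ l : List (Fin 48 × LPoly), (l.map fun e => toA e.2 • tabElt t e.1).sum =
      - ∑ y, toA (l.foldr (fun e r => subMul e.2 (tabEntry t e.1 y) r) []) • tB y := by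
    intro l
    induction l with
    | nil => simp [toA_nil]
    | cons e l ih =>
      simp only [List.map_cons, List.sum_cons, ih, List.foldr_cons, toA_subMul, sub_smul,
        Finset.sum_sub_distrib, mul_smul, ← Finset.smul_sum]
      rw [neg_sub, sub_eq_add_neg]
      rfl
  rw [key, tabElt, gB_mul_sum, eq_neg_iff_add_eq_zero, ← Finset.sum_add_distrib]
  refine Finset.sum_eq_zero fun y _ => ?_
  have h1 := congrArg toA (h i k y)
  rw [toA_actAdd, toA_nil] at h1
  rw [← add_smul]
  exact (congrArg (fun a : A => a • tB y) h1).trans (zero_smul _ _)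

theorem toA_eq_zero_of_lt (h : checkUnitriangular neg t = true) {k y : Fin 48} (hk : k < y) :
    toA (tabEntry t k y) = 0 := by
  have := checkUnitriangular_iff.1 h k y
  rw [if_neg hk.ne', if_pos hk] at this
  rw [this, toA_nil]

theorem toA_self (h : checkUnitriangular neg t = true) (k : Fin 48) :
    toA (tabEntry t k k) = 1 := by
  have := checkUnitriangular_iff.1 h k k
  rw [if_pos rfl] at this
  rw [this, toA_one]

theorem tabElt_eq_add (h : checkUnitriangular neg t = true) (k : Fin 48) :
    tabElt t k = tB k + ∑ y, (if y = k then 0 else toA (tabEntry t k y)) • tB y := by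
  have e : ∀ y, toA (tabEntry t k y) • tB y = (if k = y then tB y else 0) +
      (if y = k then 0 else toA (tabEntry t k y)) • tB y := by
    intro y
    by_cases hy : y = k
    · rw [if_pos hy, if_pos hy.symm, hy, toA_self h, one_smul, zero_smul, add_zero]
    · rw [if_neg hy, if_neg (Ne.symm hy), zero_add]
  rw [tabElt, Finset.sum_congr rfl fun y _ => e y, Finset.sum_add_distrib, Finset.sum_ite_eq,
    if_pos (Finset.mem_univ k)]

theorem tabElt_zero (h : checkUnitriangular neg t = true) : tabElt t 0 = 1 := by
  rw [tabElt_eq_add h, tB_zero, Finset.sum_eq_zero, add_zero]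
  intro y _
  by_cases hy : y = 0
  · rw [if_pos hy, zero_smul]
  · rw [if_neg hy, toA_eq_zero_of_lt h (Fin.pos_of_ne_zero hy), zero_smul]

theorem barA_toA_symm (c a b : ℤ) : barA (toA (symm c a b)) = toA (symm c a b) := by
  rw [symm]
  split_ifs
  · simp [toA, barA_single]
  · simp [toA, barA_single, add_comm]

/-- In C_k = (T_i + v_i⁻¹) C_{k'} - ∑ μ_z C_z the factor T_i + v_i⁻¹ and the symmetric coefficients
μ_z are bar-invariant, and all numbers on the right are smaller than k. -/
theorem barH_tabElt (h : checkUnitriangular neg t = true) (hp : checkProducts m t = true)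
    (hm : checkMu m = true) (k : Fin 48) : barH (tabElt t k) = tabElt t k := by
  simp only [checkMu, List.all_eq_true, List.mem_finRange, forall_const, decide_eq_true_iff] at hm
  induction k using WellFoundedLT.induction with
  | ind k ih =>
    by_cases hk : k = 0
    · rw [hk, tabElt_zero h, map_one]
    · have hlt := lm_hd_lt k hk
      set i := hd k
      have e := gB_mul_tabElt hp i (lm i k)
      rw [col, if_neg (by rw [lm_lm]; exact lt_asymm hlt), lm_lm, List.map_cons, List.map_cons,
        List.sum_cons, List.sum_cons, toA_one, one_smul] at e
      have ev : toA [(-(wtC i).1, -(wtC i).2, -1)] = -eps (-weightB 3 i) := by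
        rw [toA_cons, toA_nil, add_zero, AddMonoidAlgebra.single_neg, weightB_eq]; rfl
      have hs : barH (((mus m i (lm i k)).map fun e => toA e.2 • tabElt t e.1).sum) =
          ((mus m i (lm i k)).map fun e => toA e.2 • tabElt t e.1).sum := by
        rw [map_list_sum, List.map_map]
        refine congrArg List.sum (List.map_congr_left fun e he => ?_)
        have h1 : barA (toA e.2) = toA e.2 := by
          obtain ⟨e', -, he'⟩ := List.mem_filterMap.1 he
          split_ifs at he'
          rw [← Option.some.inj he']
          exact barA_toA_symm _ _ _
        rw [Function.comp_apply, barH_smul, h1, ih _ ((hm i _ e he).trans hlt)]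
      have e2 : tabElt t k = gB i * tabElt t (lm i k) + eps (-weightB 3 i) • tabElt t (lm i k) -
          ((mus m i (lm i k)).map fun e => toA e.2 • tabElt t e.1).sum := by
        rw [e, ev, neg_smul]; abel
      rw [e2, map_sub, hs, map_add, map_mul, barH_smul, ih _ hlt, barH_gB, barA_eps, neg_neg, gInv,
        sub_mul, ← Algebra.smul_def, xi, sub_smul]
      abel

theorem isKL_tabElt {lt : ℤ × ℤ → ℤ × ℤ → Prop} (hneg : ∀ a b, neg a b = true → lt (a, b) 0)
    (h : checkUnitriangular neg t = true) (hp : checkProducts m t = true)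
    (hm : checkMu m = true) (w : WB 3) :
    IsKL (typeB 3) (weightB 3) lt w (tabElt t (idx w)) := by
  refine (isKL_iff _ _).2 ⟨barH_tabElt h hp hm _, _, ?_, fun y => ?_, tabElt_eq_add h _⟩
  · rw [if_pos rfl]
  · have h1 := checkUnitriangular_iff.1 h (idx w) y
    split_ifs at h1 ⊢ with h2 h3
    · intro γ hγ; exact absurd rfl hγ
    · rw [h1, toA_nil]; intro γ hγ; exact absurd rfl hγ
    · intro γ hγ
      obtain ⟨u, hu, rfl⟩ := coeff_toA_ne_zero hγ
      exact hneg _ _ (h1 u hu)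

theorem exists_basis_tabElt (h : checkUnitriangular neg t = true) :
    ∃ b : Module.Basis (Fin 48) A (HB 3), ∀ k, b k = tabElt t k := by
  have hd : (tBasis.toMatrix (tabElt t)).det = 1 := by
    have e : ∀ y k, tBasis.toMatrix (tabElt t) y k = toA (tabEntry t k y) := by
      intro y k
      rw [Module.Basis.toMatrix_apply, ← Module.Basis.coord_apply, tabElt, map_sum]
      simp only [map_smul, coord_tB]
      simp
    rw [Matrix.det_of_isUpperTriangular]
    · exact Finset.prod_eq_one fun k _ => by rw [e, toA_self h]
    · intro y k hky
      rw [e]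
      exact toA_eq_zero_of_lt h hky
  have hb := (Module.Basis.is_basis_iff_det tBasis (v := tabElt t)).2
    (by rw [Module.Basis.det_apply, hd]; exact isUnit_one)
  exact ⟨Module.Basis.mk hb.1 hb.2.ge, fun k => Module.Basis.mk_apply _ _ k⟩

end Table

/-- The table `m` describes the action of the generators on the Kazhdan-Lusztig basis `b` with
respect to the order `lt`. -/
structure IsWGraph (lt : ℤ × ℤ → ℤ × ℤ → Prop) (m : MuTable)
    (b : Module.Basis (Fin 48) A (HB 3)) : Prop where
  C_eq : ∀ w, C (typeB 3) (weightB 3) lt w = b (idx w)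
  zero : b 0 = 1
  mul : ∀ i k, gB i * b k = ((col m i k).map fun e => toA e.2 • b e.1).sum

theorem exists_isWGraph {lt : ℤ × ℤ → ℤ × ℤ → Prop} {neg : ℤ → ℤ → Bool} {m : MuTable}
    (hlt : ∀ γ, lt γ 0 → ¬ lt (-γ) 0) (hneg : ∀ a b, neg a b = true → lt (a, b) 0)
    (h : checkAll neg m = true) : ∃ b, IsWGraph lt m b := by
  obtain ⟨t, ht⟩ := exists_withTab_eq (β := Bool) m 47
  rw [checkAll, ht, Bool.and_eq_true, Bool.and_eq_true] at h
  obtain ⟨hm, hu, hp⟩ := h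
  obtain ⟨b, hb⟩ := exists_basis_tabElt hu
  refine ⟨b, fun w => ?_, by rw [hb, tabElt_zero hu], fun i k => ?_⟩
  · rw [hb]; exact KazhdanLusztig.C_eq hlt (isKL_tabElt hneg hu hp hm w)
  · simp only [hb]; exact gB_mul_tabElt hp i k

theorem exists_isWGraph_asym : ∃ b, IsWGraph ltAsym muAsym b := by
  refine exists_isWGraph ?_ ?_ checkAll_asym
  · rintro ⟨a, b⟩ h h'
    simp only [ltAsym, Prod.fst_zero, Prod.snd_zero, Prod.neg_mk] at h h'
    omega
  · intro a b h
    simp only [negAsym, Bool.or_eq_true, Bool.and_eq_true, decide_eq_true_iff] at h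
    exact h

theorem exists_isWGraph_weighted : ∃ b, IsWGraph ltWeighted muWeighted b := by
  refine exists_isWGraph ?_ ?_ checkAll_weighted
  · rintro ⟨a, b⟩ h h'
    simp only [ltWeighted, Prod.fst_zero, Prod.snd_zero, Prod.neg_mk] at h h'
    omega
  · intro a b h
    simp only [negWeighted, Bool.or_eq_true, Bool.and_eq_true, decide_eq_true_iff] at h
    simpa [ltWeighted] using h

/-! ## Left cells and their modules -/

/-- The coefficient of `C_z` in the product of `T_i` and `C_k`. -/
def coef (m : MuTable) (i : Fin 3) (k z : Fin 48) : A := toA (entry (col m i k) z)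

theorem mem_of_coef_ne_zero {m : MuTable} {i : Fin 3} {k z : Fin 48} (h : coef m i k z ≠ 0) :
    ∃ e ∈ col m i k, e.1 = z := by
  by_contra! h0
  refine h ?_
  have key : ∀ l : List (Fin 48 × LPoly), (∀ e ∈ l, e.1 ≠ z) → entry l z = [] := by
    intro l hl
    induction l with
    | nil => rfl
    | cons e l ih =>
      have e1 : entry (e :: l) z = if e.1 = z then e.2 ++ entry l z else entry l z := rfl
      rw [e1, if_neg (hl e List.mem_cons_self), ih fun e he => hl e (List.mem_cons_of_mem _ he)]
  rw [coef, key _ h0, toA_nil]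

section WGraph

variable {lt : ℤ × ℤ → ℤ × ℤ → Prop} {m : MuTable} {b : Module.Basis (Fin 48) A (HB 3)}

/-- The left preorder. -/
local notation "LE[" lt "]" => LeftLE (typeB 3) (weightB 3) lt

theorem IsWGraph.gB_mul (hW : IsWGraph lt m b) (i : Fin 3) (k : Fin 48) :
    gB i * b k = ∑ z, coef m i k z • b z := by
  rw [hW.mul]; exact (sum_entry_smul _ _).symm

theorem IsWGraph.occurs_iff (hW : IsWGraph lt m b) (z : WB 3) (h : HB 3) :
    Occurs (typeB 3) (weightB 3) lt z h ↔ b.repr h (idx z) ≠ 0 := by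
  have : Fintype (WB 3) := Fintype.ofEquiv _ idxEquiv.symm
  have key : ∀ f : WB 3 →₀ A, (f.sum fun y a => a • C (typeB 3) (weightB 3) lt y) =
      ∑ k, f (elem k) • b k := by
    intro f
    rw [Finsupp.sum_fintype f (fun y a => a • C (typeB 3) (weightB 3) lt y) fun y => zero_smul _ _,
      ← idxEquiv.symm.sum_comp]
    refine Finset.sum_congr rfl fun k _ => ?_
    rw [hW.C_eq]
    exact congrArg (fun z => f (elem k) • b z) (idx_elem k)
  have hrepr : ∀ f : WB 3 →₀ A, b.repr (∑ k, f (elem k) • b k) (idx z) = f z := by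
    intro f
    rw [b.repr_sum_self fun k => f (elem k)]
    exact congrArg f (elem_idx z)
  constructor
  · rintro ⟨f, h1, h2⟩
    rw [key] at h2
    rwa [h2, hrepr]
  · intro h1
    refine ⟨Finsupp.equivFunOnFinite.symm fun y => b.repr h (idx y), h1, ?_⟩
    rw [key]
    simp only [Finsupp.equivFunOnFinite_symm_apply_apply, idx_elem]
    exact (b.sum_repr h).symm

/-- As the table has no entries for the identity, the product T_i · 1 reads C_s = T_s + v_s⁻¹. -/
theorem IsWGraph.C_simple_mul (hW : IsWGraph lt m b) (hm : ∀ i, mus m i 0 = []) (i : Fin 3)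
    (h : HB 3) : C (typeB 3) (weightB 3) lt ((typeB 3).simple i) * h =
      gB i * h + eps (-weightB 3 i) • h := by
  have h0 : ¬ lm i 0 < 0 := Fin.not_lt_zero _
  have h1 := hW.mul i 0
  have ev : toA [(-(wtC i).1, -(wtC i).2, -1)] = -eps (-weightB 3 i) := by
    rw [toA_cons, toA_nil, add_zero, AddMonoidAlgebra.single_neg, weightB_eq]; rfl
  rw [col, if_neg h0, hm, hW.zero, mul_one] at h1
  simp only [List.map_cons, List.map_nil, List.sum_cons, List.sum_nil, add_zero, toA_one, one_smul,
    hW.zero, ev] at h1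
  have h2 : idx ((typeB 3).simple i) = lm i 0 := by
    have := idx_simple_mul i 1
    rwa [mul_one, idx_one] at this
  rw [hW.C_eq, h2, h1, add_mul, neg_smul, neg_mul, smul_mul_assoc, one_mul]
  abel

/-- Replacing C_s by T_s changes only the coefficient of C_y itself. -/
theorem IsWGraph.leftStep_iff (hW : IsWGraph lt m b) (hm : ∀ i, mus m i 0 = []) {z y : WB 3}
    (hne : z ≠ y) : LeftStep (typeB 3) (weightB 3) lt z y ↔ ∃ i, coef m i (idx y) (idx z) ≠ 0 := by
  refine exists_congr fun i => ?_
  rw [hW.C_simple_mul hm, hW.C_eq, hW.occurs_iff, hW.gB_mul, map_add, map_smul, Finsupp.add_apply,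
    b.repr_sum_self (coef m i (idx y)), Module.Basis.repr_self, Finsupp.smul_apply,
    Finsupp.single_eq_of_ne fun h => hne (idx_injective h), smul_zero, add_zero]

theorem IsWGraph.leftLE_of_coef (hW : IsWGraph lt m b) (hm : ∀ i, mus m i 0 = []) {z y : WB 3}
    {i : Fin 3} (h : coef m i (idx y) (idx z) ≠ 0) : LE[lt] z y := by
  by_cases hne : z = y
  · rw [hne]; exact Relation.ReflTransGen.refl
  · exact Relation.ReflTransGen.single ((hW.leftStep_iff hm hne).2 ⟨i, h⟩)

/-- Sets of numbers which are stable under left multiplication contain the left lower sets of their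
elements. -/
theorem IsWGraph.idx_mem_of_leftLE (hW : IsWGraph lt m b) (hm : ∀ i, mus m i 0 = [])
    {S : Fin 48 → Prop} (hS : ∀ k, S k → ∀ i, ∀ e ∈ col m i k, S e.1) {z y : WB 3}
    (h : LE[lt] z y) (hy : S (idx y)) : S (idx z) := by
  induction h using Relation.ReflTransGen.head_induction_on with
  | refl => exact hy
  | @head x x' h1 _ ih =>
    by_cases hne : x = x'
    · rwa [hne]
    · obtain ⟨i, hi⟩ := (hW.leftStep_iff hm hne).1 h1
      obtain ⟨e, he, he'⟩ := mem_of_coef_ne_zero hi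
      rw [← he']
      exact hS _ ih i e he

/-- The adjacency of two elements through a product with a generator. -/
def adj (m : MuTable) (k z : Fin 48) : Bool :=
  (List.finRange 3).any fun i => headSurvives (entry (col m i k) z)

/-- A function `lev` on the elements whose fibres are the left cells. -/
structure IsLevel (m : MuTable) (lev : Fin 48 → ℕ) : Prop where
  mus_zero : ∀ i, mus m i 0 = []
  le : ∀ i k, ∀ e ∈ col m i k, lev k ≤ lev e.1
  connected : ∀ y z, lev y = lev z →
    y = z ∨ adj m y z = true ∨ ∃ x, lev x = lev y ∧ adj m y x = true ∧ adj m x z = true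

variable {lev : Fin 48 → ℕ}

theorem IsWGraph.lev_le (hW : IsWGraph lt m b) (hl : IsLevel m lev) {z y : WB 3} (h : LE[lt] z y) :
    lev (idx y) ≤ lev (idx z) :=
  hW.idx_mem_of_leftLE hl.mus_zero (S := fun k => lev (idx y) ≤ lev k)
    (fun k hk i e he => hk.trans (hl.le i k e he)) h le_rfl

theorem IsWGraph.leftLE_of_adj (hW : IsWGraph lt m b) (hl : IsLevel m lev) {z y : WB 3}
    (h : adj m (idx y) (idx z) = true) : LE[lt] z y := by
  obtain ⟨i, -, hi⟩ := List.any_eq_true.1 h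
  exact hW.leftLE_of_coef hl.mus_zero (toA_ne_zero hi)

theorem IsWGraph.leftLE_of_lev_eq (hW : IsWGraph lt m b) (hl : IsLevel m lev) {z y : WB 3}
    (h : lev (idx y) = lev (idx z)) : LE[lt] z y := by
  rcases hl.connected _ _ h with h | h | ⟨x, -, h1, h2⟩
  · rw [idx_injective h]; exact Relation.ReflTransGen.refl
  · exact hW.leftLE_of_adj hl h
  · rw [← idx_elem x] at h1 h2
    exact (hW.leftLE_of_adj hl h2).trans (hW.leftLE_of_adj hl h1)

/-- Along every edge `lev` weakly increases, so it is constant on cells. Any two elements with the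
same value are joined by at most two edges in each direction, so the fibres are not larger than
cells. -/
theorem IsWGraph.isLeftCell_iff (hW : IsWGraph lt m b) (hl : IsLevel m lev) (c : Set (WB 3)) :
    IsLeftCell (typeB 3) (weightB 3) lt c ↔ ∃ k, c = {w | lev (idx w) = lev k} := by
  have key : ∀ w, {y | LE[lt] y w ∧ LE[lt] w y} = {y | lev (idx y) = lev (idx w)} := by
    intro w
    ext y
    exact ⟨fun h => le_antisymm (hW.lev_le hl h.2) (hW.lev_le hl h.1), fun h =>
      ⟨hW.leftLE_of_lev_eq hl h.symm, hW.leftLE_of_lev_eq hl h⟩⟩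
  constructor
  · rintro ⟨w, rfl⟩
    exact ⟨idx w, key w⟩
  · rintro ⟨k, rfl⟩
    refine ⟨elem k, ?_⟩
    rw [key, idx_elem]

/-- The cell ideals are defined as spans over the Hecke algebra; this bounds them by A-spans of
basis elements. -/
theorem mem_of_mem_span {X : Set (HB 3)} {S : Submodule A (HB 3)}
    (hS : ∀ i, ∀ x ∈ S, gB i * x ∈ S) (hX : X ⊆ S) {h : HB 3}
    (hh : h ∈ Submodule.span (HB 3) X) : h ∈ S := by
  induction hh using Submodule.span_induction with
  | mem x hx => exact hX hx
  | zero => exact S.zero_mem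
  | add x y _ _ hx hy => exact S.add_mem hx hy
  | smul a x _ hx => exact mul_mem_of_gB_mul_mem hS a x hx

theorem IsWGraph.gB_mul_mem_span (hW : IsWGraph lt m b) {D : Set (Fin 48)}
    (hD : ∀ k ∈ D, ∀ i z, coef m i k z ≠ 0 → z ∈ D) (i : Fin 3) :
    ∀ x ∈ Submodule.span A (b '' D), gB i * x ∈ Submodule.span A (b '' D) := by
  intro x hx
  induction hx using Submodule.span_induction with
  | mem x hx =>
    obtain ⟨k, hk, rfl⟩ := hx
    rw [hW.gB_mul]
    refine Submodule.sum_mem _ fun z _ => ?_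
    by_cases hz : coef m i k z = 0
    · rw [hz, zero_smul]; exact Submodule.zero_mem _
    · exact Submodule.smul_mem _ _ (Submodule.subset_span ⟨z, hD k hk i z hz, rfl⟩)
  | zero => rw [mul_zero]; exact Submodule.zero_mem _
  | add x y _ _ hx hy => rw [mul_add]; exact Submodule.add_mem _ hx hy
  | smul a x _ hx => rw [mul_smul_comm]; exact Submodule.smul_mem _ _ hx

/-! ### Bases of the cell modules -/

section Cell

variable {c : Set (WB 3)}

theorem IsWGraph.mem_cellIdeal (hW : IsWGraph lt m b) (hm : ∀ i, mus m i 0 = []) {h : HB 3}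
    (hh : h ∈ cellIdeal (typeB 3) (weightB 3) lt c) :
    h ∈ Submodule.span A (b '' {k | ∃ w ∈ c, LE[lt] (elem k) w}) := by
  refine mem_of_mem_span (hW.gB_mul_mem_span ?_) ?_ hh
  · rintro k ⟨w, hw, hk⟩ i z hz
    refine ⟨w, hw, Relation.ReflTransGen.trans (hW.leftLE_of_coef hm (i := i) ?_) hk⟩
    rwa [idx_elem, idx_elem]
  · rintro _ ⟨y, ⟨w, hw, hy⟩, rfl⟩
    rw [hW.C_eq]
    exact Submodule.subset_span ⟨idx y, ⟨w, hw, by rwa [elem_idx]⟩, rfl⟩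

theorem IsWGraph.mem_cellIdealHat (hW : IsWGraph lt m b) (hm : ∀ i, mus m i 0 = [])
    (hc : IsLeftCell (typeB 3) (weightB 3) lt c) {h : HB 3}
    (hh : h ∈ cellIdealHat (typeB 3) (weightB 3) lt c) :
    h ∈ Submodule.span A (b '' {k | elem k ∉ c}) := by
  have : h ∈ Submodule.span A (b '' {k | (∃ w ∈ c, LE[lt] (elem k) w) ∧ elem k ∉ c}) := by
    refine mem_of_mem_span (hW.gB_mul_mem_span ?_) ?_ hh
    · rintro k ⟨⟨w, hw, hk⟩, hkc⟩ i z hz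
      have h1 : LE[lt] (elem z) (elem k) :=
        hW.leftLE_of_coef hm (i := i) (by rwa [idx_elem, idx_elem])
      -- If z ≤ k ≤ w with z and w in the cell, then k is in the cell. So the part strictly below
      -- the cell is stable.
      refine ⟨⟨w, hw, Relation.ReflTransGen.trans h1 hk⟩, fun hzc => hkc ?_⟩
      obtain ⟨w₀, rfl⟩ := hc
      exact ⟨Relation.ReflTransGen.trans hk hw.1, Relation.ReflTransGen.trans hzc.2 h1⟩
    · rintro _ ⟨y, ⟨w, hw, hy⟩, hyc, rfl⟩
      rw [hW.C_eq]
      exact Submodule.subset_span ⟨idx y, ⟨⟨w, hw, by rwa [elem_idx]⟩, by rwa [elem_idx]⟩, rfl⟩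
  exact Submodule.span_mono (Set.image_mono fun k hk => hk.2) this

theorem IsWGraph.coord_eq_zero (hW : IsWGraph lt m b) (hm : ∀ i, mus m i 0 = [])
    (hc : IsLeftCell (typeB 3) (weightB 3) lt c) {h : HB 3}
    (hh : h ∈ cellIdealHat (typeB 3) (weightB 3) lt c) {w : WB 3} (hw : w ∈ c) :
    b.coord (idx w) h = 0 := by
  have h1 := hW.mem_cellIdealHat hm hc hh
  have h2 : Submodule.span A (b '' {k | elem k ∉ c}) ≤ LinearMap.ker (b.coord (idx w)) := by
    rw [Submodule.span_le]
    rintro _ ⟨k, hk, rfl⟩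
    rw [SetLike.mem_coe, LinearMap.mem_ker, Module.Basis.coord_apply, Module.Basis.repr_self,
      Finsupp.single_eq_of_ne]
    rintro rfl
    exact hk (by rwa [elem_idx])
  exact h2 h1

/-- The cell module of a left cell has the basis of the classes of the `C_w`, on which the generators
act by the coefficients of the W-graph. -/
theorem IsWGraph.exists_cellBasis (hW : IsWGraph lt m b) (hm : ∀ i, mus m i 0 = [])
    (hc : IsLeftCell (typeB 3) (weightB 3) lt c) {ι : Type*} [Fintype ι] (w : ι → WB 3)
    (hinj : Function.Injective w) (hmem : ∀ j, w j ∈ c) (hsurj : ∀ y ∈ c, ∃ j, w j = y) :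
    ∃ bb : Module.Basis ι A (CellModule (typeB 3) (weightB 3) lt c),
      (∀ j, bb j = cellClass (typeB 3) (weightB 3) lt c (w j) (hmem j)) ∧
      ∀ i j, gB i • bb j = ∑ k, coef m i (idx (w j)) (idx (w k)) • bb k := by
  classical
  let I := cellIdeal (typeB 3) (weightB 3) lt c
  let J := cellIdealHat (typeB 3) (weightB 3) lt c
  have hmemI : ∀ j, b (idx (w j)) ∈ I := fun j =>
    Submodule.subset_span ⟨w j, ⟨w j, hmem j, Relation.ReflTransGen.refl⟩, (hW.C_eq _).symm⟩
  let x (j : ι) : I := ⟨b (idx (w j)), hmemI j⟩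
  let π : I →ₗ[A] CellModule (typeB 3) (weightB 3) lt c :=
    ((J.submoduleOf I).mkQ).restrictScalars A
  have hx : ∀ j, π (x j) = cellClass (typeB 3) (weightB 3) lt c (w j) (hmem j) := by
    intro j
    have : x j = ⟨C (typeB 3) (weightB 3) lt (w j), Submodule.subset_span
        ⟨w j, ⟨w j, hmem j, Relation.ReflTransGen.refl⟩, rfl⟩⟩ := Subtype.ext (hW.C_eq _).symm
    rw [this]; rfl
  have hπ : ∀ y : I, π y = 0 ↔ (y : HB 3) ∈ J := by
    intro y
    exact Submodule.Quotient.mk_eq_zero (J.submoduleOf I)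
  have hli : LinearIndependent A fun j => π (x j) := by
    rw [Fintype.linearIndependent_iff]
    intro g hg j
    have h1 : π (∑ j, g j • x j) = 0 := by rw [map_sum]; simpa using hg
    have h2 := hW.coord_eq_zero hm hc ((hπ _).1 h1) (hmem j)
    have h3 : ((∑ j, g j • x j : I) : HB 3) = ∑ j, g j • b (idx (w j)) := by
      rw [Submodule.coe_sum]; rfl
    rw [h3, map_sum] at h2
    have hiff : ∀ k, idx (w k) = idx (w j) ↔ k = j := fun k => (idx_injective.comp hinj).eq_iff
    simp only [map_smul, Module.Basis.coord_apply, Module.Basis.repr_self, Finsupp.single_apply,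
      hiff, smul_eq_mul] at h2
    simpa using h2
  have hspan : ⊤ ≤ Submodule.span A (Set.range fun j => π (x j)) := by
    let N := (Submodule.span A (Set.range fun j => π (x j))).comap π
    have h1 : Submodule.span A (b '' {k | ∃ w ∈ c, LE[lt] (elem k) w}) ≤
        N.map (I.subtype.restrictScalars A) := by
      rw [Submodule.span_le]
      rintro _ ⟨k, ⟨w', hw', hk⟩, rfl⟩
      have hk' : b k ∈ I := Submodule.subset_span
        ⟨elem k, ⟨w', hw', hk⟩, by rw [hW.C_eq, idx_elem]⟩
      refine ⟨⟨b k, hk'⟩, ?_, rfl⟩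
      change π ⟨b k, hk'⟩ ∈ Submodule.span A (Set.range fun j => π (x j))
      by_cases hkc : elem k ∈ c
      · obtain ⟨j, hj⟩ := hsurj _ hkc
        refine Submodule.subset_span ⟨j, congrArg π (Subtype.ext ?_)⟩
        change b (idx (w j)) = b k
        rw [hj, idx_elem]
      · have h0 : π ⟨b k, hk'⟩ = 0 := (hπ _).2 (Submodule.subset_span
          ⟨elem k, ⟨w', hw', hk⟩, hkc, by rw [hW.C_eq, idx_elem]⟩)
        rw [h0]; exact Submodule.zero_mem _
    intro y _
    obtain ⟨⟨h, hh⟩, rfl⟩ := Submodule.Quotient.mk_surjective _ y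
    obtain ⟨n, hn, hn'⟩ := h1 (hW.mem_cellIdeal hm hh)
    have : n = ⟨h, hh⟩ := Subtype.ext hn'
    rw [← this]; exact hn
  let bb := Module.Basis.mk hli hspan
  have hbb : ∀ j, bb j = π (x j) := fun j => Module.Basis.mk_apply _ _ j
  refine ⟨bb, fun j => (hbb j).trans (hx j), fun i j => ?_⟩
  simp only [hbb]
  have e1 : gB i • π (x j) = π (gB i • x j) := rfl
  have e2 : ∑ k, coef m i (idx (w j)) (idx (w k)) • π (x k) =
      π (∑ k, coef m i (idx (w j)) (idx (w k)) • x k) := by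
    rw [map_sum]; simp
  rw [e1, e2, ← sub_eq_zero, ← map_sub, hπ]
  -- The terms of T_i C_w with index in the cell cancel, and the remaining ones lie in the smaller
  -- ideal.
  have e3 : ((gB i • x j - ∑ k, coef m i (idx (w j)) (idx (w k)) • x k : I) : HB 3) =
      ∑ z ∈ Finset.univ.filter (fun z => elem z ∉ c), coef m i (idx (w j)) z • b z := by
    have h1 : ((gB i • x j - ∑ k, coef m i (idx (w j)) (idx (w k)) • x k : I) : HB 3) =
        gB i * b (idx (w j)) - ∑ k, coef m i (idx (w j)) (idx (w k)) • b (idx (w k)) := by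
      rw [Submodule.coe_sub, Submodule.coe_sum]; rfl
    rw [h1, hW.gB_mul, sub_eq_iff_eq_add,
      ← Finset.sum_filter_add_sum_filter_not Finset.univ (fun z => elem z ∉ c)]
    congr 1
    symm
    refine Finset.sum_bij (fun k _ => idx (w k)) ?_ ?_ ?_ ?_
    · intro k _; simp [elem_idx, hmem]
    · intro k _ k' _ h; exact hinj (idx_injective h)
    · intro z hz
      obtain ⟨k, hk⟩ := hsurj (elem z) (by simpa using hz)
      exact ⟨k, Finset.mem_univ _, by rw [hk, idx_elem]⟩
    · intro k _; rfl
  rw [e3]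
  refine Submodule.sum_mem _ fun z hz => ?_
  by_cases h0 : coef m i (idx (w j)) z = 0
  · rw [h0, zero_smul]; exact Submodule.zero_mem _
  · rw [Algebra.smul_def]
    refine Submodule.smul_mem _ _ (Submodule.subset_span ⟨elem z, ⟨w j, hmem j, ?_⟩, ?_, ?_⟩)
    · exact hW.leftLE_of_coef hm (i := i) (by rwa [idx_elem])
    · simpa using hz
    · rw [hW.C_eq, idx_elem]

end Cell

end WGraph

/-! ## The left cells of `W_3` -/

/-- The numbers of the left cells, for the lexicographic order, in a linear order that refines the
left order. -/
def levAsym (k : Fin 48) : ℕ :=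
  [0, 1, 2, 3, 5, 7, 1, 3, 2, 8, 4, 6, 5, 7, 11, 1, 13, 10, 12, 8, 4, 6, 7, 5, 14, 9, 10, 13, 12, 8,
    6, 4, 16, 15, 9, 14, 10, 13, 12, 17, 18, 16, 9, 14, 18, 17, 16, 19].getD k 0

/-- The numbers of the left cells for the weighted lexicographic order. -/
def levWeighted (k : Fin 48) : ℕ :=
  [0, 1, 2, 3, 5, 7, 1, 3, 2, 8, 4, 6, 5, 7, 12, 1, 13, 7, 12, 10, 4, 6, 11, 5, 14, 6, 11, 13, 12,
    10, 9, 4, 16, 10, 9, 14, 11, 13, 15, 17, 18, 16, 9, 14, 18, 17, 16, 19].getD k 0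

theorem isLevel_asym : IsLevel muAsym levAsym where
  mus_zero := by decide +kernel
  le := by decide +kernel
  connected := by decide +kernel

theorem isLevel_weighted : IsLevel muWeighted levWeighted where
  mus_zero := by decide +kernel
  le := by decide +kernel
  connected := by decide +kernel

/-- The numbers of the elements of the left cell for the lexicographic order. -/
def asymIdx : Fin 3 → Fin 48 := ![5, 13, 22]

/-- The numbers of the elements of the three left cells for the weighted lexicographic order. -/
def weightedIdx : Fin 3 → Fin 3 → Fin 48 := ![![14, 28, 18], ![22, 36, 26], ![30, 42, 34]]

theorem idx_elt (ω : List (Fin 3)) : idx (elt ω) = ω.foldr lm 0 := idx_wordProd ω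

theorem elt_mul_elt (ω ω' : List (Fin 3)) : elt ω * elt ω' = elt (ω ++ ω') :=
  (csB.wordProd_append ω ω').symm

theorem idx_asymElt (j : Fin 3) : idx (asymElt j) = asymIdx j := by
  fin_cases j
  · exact (idx_elt [2, 0]).trans (by decide +kernel)
  · exact (idx_elt [1, 2, 0]).trans (by decide +kernel)
  · exact (idx_elt [2, 1, 2, 0]).trans (by decide +kernel)

theorem idx_weightedElt (k j : Fin 3) : idx (weightedElt k j) = weightedIdx k j := by
  have h : weightedElt k j = elt ((![[1, 2, 1], [1, 0, 1, 2, 1], [0, 1, 2, 1]] : Fin 3 → _) j ++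
      (![[], [0], [0, 1]] : Fin 3 → _) k) := by
    rw [← elt_mul_elt]
    fin_cases k <;> fin_cases j <;> rfl
  rw [h, idx_elt]
  clear h
  revert k j
  decide +kernel

theorem asymElt_injective : Function.Injective asymElt := by
  have key : ∀ i j, asymIdx i = asymIdx j → i = j := by decide
  intro i j h
  apply key
  rw [← idx_asymElt, ← idx_asymElt, h]

theorem weightedElt_injective (k : Fin 3) : Function.Injective (weightedElt k) := by
  have key : ∀ k i j, weightedIdx k i = weightedIdx k j → i = j := by decide
  intro i j h
  apply key k
  rw [← idx_weightedElt, ← idx_weightedElt, h]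

theorem range_asymElt : Set.range asymElt = {w | levAsym (idx w) = levAsym 5} := by
  have h : ∀ k, levAsym k = levAsym 5 ↔ ∃ j, asymIdx j = k := by decide +kernel
  ext w
  rw [Set.mem_ofPred_eq, h, Set.mem_range]
  refine exists_congr fun j => ?_
  rw [← idx_asymElt, idx_injective.eq_iff]

theorem range_weightedElt (k : Fin 3) :
    Set.range (weightedElt k) = {w | levWeighted (idx w) = levWeighted (weightedIdx k 0)} := by
  have h : ∀ k y, levWeighted y = levWeighted (weightedIdx k 0) ↔ ∃ j, weightedIdx k j = y := by
    decide +kernel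
  ext w
  rw [Set.mem_ofPred_eq, h, Set.mem_range]
  refine exists_congr fun j => ?_
  rw [← idx_weightedElt, idx_injective.eq_iff]

theorem isLeftCell_asym : IsLeftCell (typeB 3) (weightB 3) ltAsym (Set.range asymElt) := by
  obtain ⟨b, hW⟩ := exists_isWGraph_asym
  exact (hW.isLeftCell_iff isLevel_asym _).2 ⟨5, range_asymElt⟩

theorem isLeftCell_weighted (k : Fin 3) :
    IsLeftCell (typeB 3) (weightB 3) ltWeighted (Set.range (weightedElt k)) := by
  obtain ⟨b, hW⟩ := exists_isWGraph_weighted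
  exact (hW.isLeftCell_iff isLevel_weighted _).2 ⟨_, range_weightedElt k⟩

theorem range_weightedElt_injective : Function.Injective fun k => Set.range (weightedElt k) := by
  have key : ∀ k k' j, weightedIdx k' j = weightedIdx k 0 → k = k' := by decide
  intro k k' h
  have h1 : weightedElt k 0 ∈ Set.range (weightedElt k') := by
    rw [← show Set.range (weightedElt k) = Set.range (weightedElt k') from h]
    exact Set.mem_range_self 0
  obtain ⟨j, hj⟩ := h1
  apply key k k' j
  rw [← idx_weightedElt, ← idx_weightedElt, hj]

/-! ### The matrices of the generators -/

theorem coef_asym (i j k : Fin 3) : coef muAsym i (asymIdx j) (asymIdx k) = rhoLam i k j := by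
  have h : ∀ i j k, entry (col muAsym i (asymIdx j)) (asymIdx k) =
      (![!![[(1, 0, 1)], symm 1 1 (-1), symm 1 1 (-2); [], [(-1, 0, -1)], [];
            [], [], [(-1, 0, -1)]],
        !![[(0, -1, -1)], [], []; [(0, 0, 1)], [(0, 1, 1)], []; [], [], [(0, 1, 1)]],
        !![[(0, 1, 1)], [(0, 0, 1)], []; [], [(0, -1, -1)], [];
          [], [(0, 0, 1)], [(0, 1, 1)]]] : Fin 3 → Matrix (Fin 3) (Fin 3) LPoly) i k j := by
    decide +kernel
  rw [coef, h]
  fin_cases i <;> fin_cases j <;> fin_cases k <;>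
    simp [rhoLam, toA, symm, p1, p2, mon, eps, AddMonoidAlgebra.one_def, AddMonoidAlgebra.single_neg] <;> rfl

theorem coef_weighted (n i j k : Fin 3) :
    coef muWeighted i (weightedIdx n j) (weightedIdx n k) = rho i k j := by
  have h : ∀ n i j k, entry (col muWeighted i (weightedIdx n j)) (weightedIdx n k) =
      (![!![[(-1, 0, -1)], [], []; [], [(-1, 0, -1)], [];
            [(0, 0, 1)], symm 1 1 (-1), [(1, 0, 1)]],
        !![[(0, 1, 1)], [], []; [], [(0, 1, 1)], [(0, 0, 1)]; [], [], [(0, -1, -1)]],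
        !![[(0, 1, 1)], symm 1 1 (-2), []; [], [(0, -1, -1)], [];
          [], [(0, 0, 1)], [(0, 1, 1)]]] : Fin 3 → Matrix (Fin 3) (Fin 3) LPoly) i k j := by
    decide +kernel
  rw [coef, h]
  fin_cases i <;> fin_cases j <;> fin_cases k <;>
    simp [rho, toA, symm, p1, p2, mon, eps, AddMonoidAlgebra.one_def, AddMonoidAlgebra.single_neg] <;> rfl

theorem exists_basis_asym :
    ∃ b : Module.Basis (Fin 3) A (CellModuleB3 ltAsym (Set.range asymElt)),
      (∀ j, b j = cellClass (typeB 3) (weightB 3) ltAsym (Set.range asymElt) (asymElt j)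
        (Set.mem_range_self j)) ∧
      ActsBy (typeB 3) (weightB 3) b rhoLam := by
  obtain ⟨b, hW⟩ := exists_isWGraph_asym
  obtain ⟨bb, h1, h2⟩ := hW.exists_cellBasis isLevel_asym.mus_zero isLeftCell_asym asymElt
    asymElt_injective Set.mem_range_self fun y hy => hy
  refine ⟨bb, h1, fun i j => (h2 i j).trans (Finset.sum_congr rfl fun k _ => ?_)⟩
  rw [idx_asymElt, idx_asymElt, coef_asym]

theorem exists_basis_weighted (n : Fin 3) :
    ∃ b : Module.Basis (Fin 3) A (CellModuleB3 ltWeighted (Set.range (weightedElt n))),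
      (∀ j, b j = cellClass (typeB 3) (weightB 3) ltWeighted (Set.range (weightedElt n))
        (weightedElt n j) (Set.mem_range_self j)) ∧
      ActsBy (typeB 3) (weightB 3) b rho := by
  obtain ⟨b, hW⟩ := exists_isWGraph_weighted
  obtain ⟨bb, h1, h2⟩ := hW.exists_cellBasis isLevel_weighted.mus_zero (isLeftCell_weighted n)
    (weightedElt n) (weightedElt_injective n) Set.mem_range_self fun y hy => hy
  refine ⟨bb, h1, fun i j => (h2 i j).trans (Finset.sum_congr rfl fun k _ => ?_)⟩
  rw [idx_weightedElt, idx_weightedElt, coef_weighted]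

/-! ## The intertwiner -/

theorem matP_mul_rhoLam (i : Fin 3) : matP * rhoLam i = rho i * matP := by
  fin_cases i <;> ext j k : 1 <;> fin_cases j <;> fin_cases k <;>
    simp [matP, rhoLam, rho, Matrix.mul_apply, Fin.sum_univ_three] <;> ring

theorem mon_mul_mon (i j i' j' : ℤ) : mon i j * mon i' j' = mon (i + i') (j + j') :=
  eps_mul_eps (i, j) (i', j')

theorem mon_add_mon_ne_zero {i j i' j' : ℤ} (h : i ≠ i' ∨ j ≠ j') : mon i j + mon i' j' ≠ 0 := by
  have e : mon i j + mon i' j' = toA [(i, j, 1), (i', j', 1)] := by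
    simp [toA, mon, eps]
  rw [e]
  refine toA_ne_zero ?_
  simp only [headSurvives, List.all_cons, List.all_nil]
  rcases h with h | h <;> simp [Ne.symm h]

theorem p2_ne_zero : p2 ≠ 0 := mon_add_mon_ne_zero (Or.inl (by decide))

/-- Setting V = v = 1 and reducing modulo 2 maps p_2 to 0. -/
theorem not_isUnit_p2 : ¬ IsUnit p2 := by
  intro h
  have h1 := h.map (AddMonoidAlgebra.lift ℤ (ZMod 2) (ℤ × ℤ) 1)
  have h2 : AddMonoidAlgebra.lift ℤ (ZMod 2) (ℤ × ℤ) 1 p2 = 0 := by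
    rw [p2, mon, mon, eps, eps, map_add, AddMonoidAlgebra.lift_single,
      AddMonoidAlgebra.lift_single]
    decide
  rw [h2] at h1
  exact not_isUnit_zero h1

/-- The first column of Q is an eigenvector of ρ(T_t) for V, hence a multiple of the third basis
vector. The other columns are then determined, since T_{s_1}e_0 = e_1 - v⁻¹e_0 and T_{s_2}e_1 = e_0
- v⁻¹e_1 + e_2 under ρ_λ. -/
theorem intertwiner_unique (Q : Matrix (Fin 3) (Fin 3) K)
    (hQ : ∀ i : Fin 3, Q * (rhoLam i).map (algebraMap A K) = (rho i).map (algebraMap A K) * Q) :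
    ∃ a : K, Q = a • matP.map (algebraMap A K) := by
  have hV : algebraMap A K (mon 1 0) + algebraMap A K (mon (-1) 0) ≠ 0 := by
    rw [← map_add]
    exact (map_ne_zero_iff _ (IsFractionRing.injective A K)).2
      (mon_add_mon_ne_zero (Or.inl (by decide)))
  have h0 (j k) := congrFun (congrFun (hQ 0) j) k
  have h1 (j k) := congrFun (congrFun (hQ 1) j) k
  have h2 (j k) := congrFun (congrFun (hQ 2) j) k
  simp only [rhoLam, rho, Matrix.mul_apply, Fin.sum_univ_three, Matrix.map_apply] at h0 h1 h2
  have a00 := h0 0 0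
  have a10 := h0 1 0
  have b0 := h1 0 0
  have b1 := h1 1 0
  have b2 := h1 2 0
  have c0 := h2 0 1
  have c1 := h2 1 1
  have c2 := h2 2 1
  simp at a00 a10 b0 b1 b2 c0 c1 c2
  have q00 : Q 0 0 = 0 := (mul_eq_zero.1 (by linear_combination a00 :
    (algebraMap A K (mon 1 0) + algebraMap A K (mon (-1) 0)) * Q 0 0 = 0)).resolve_left hV
  have q10 : Q 1 0 = 0 := (mul_eq_zero.1 (by linear_combination a10 :
    (algebraMap A K (mon 1 0) + algebraMap A K (mon (-1) 0)) * Q 1 0 = 0)).resolve_left hV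
  have q01 : Q 0 1 = 0 := by simpa [q00] using b0
  have q11 : Q 1 1 = Q 2 0 := by simpa [q10] using b1
  have q21 : Q 2 1 = 0 := by linear_combination b2
  have q02 : Q 0 2 = Q 2 0 * algebraMap A K p2 := by
    rw [q00, q01, q11] at c0; linear_combination c0
  have q12 : Q 1 2 = 0 := by rw [q10] at c1; linear_combination c1
  have q22 : Q 2 2 = 0 := by rw [q21, q11] at c2; linear_combination c2
  -- The corresponding entry of P is 1.
  refine ⟨Q 2 0, ?_⟩
  ext j k
  fin_cases j <;> fin_cases k <;> simp [matP, q00, q01, q02, q10, q11, q12, q21, q22]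

/-- The entry 1 of P forces a ∈ A, and then the non-unit p_2 divides det(aP) = -a³p_2. -/
theorem not_isUnit_det_of_map_eq : ¬ ∃ (a : K) (Q : Matrix (Fin 3) (Fin 3) A),
    Q.map (algebraMap A K) = a • matP.map (algebraMap A K) ∧ IsUnit Q.det := by
  rintro ⟨a, Q, hQ, hu⟩
  have hinj := IsFractionRing.injective A K
  have h (j k) := congrFun (congrFun hQ j) k
  have ha : a = algebraMap A K (Q 2 0) := by simpa [matP] using (h 2 0).symm
  have hz : ∀ j k, matP j k = 0 → Q j k = 0 := by
    intro j k hjk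
    have := h j k
    rw [Matrix.map_apply, Matrix.smul_apply, Matrix.map_apply, hjk, map_zero, smul_zero] at this
    exact (map_eq_zero_iff _ hinj).1 this
  have h1 : Q 1 1 = Q 2 0 := hinj (by simpa [matP, ha] using h 1 1)
  have h2 : Q 0 2 = Q 2 0 * p2 := hinj (by rw [map_mul]; simpa [matP, ha] using h 0 2)
  have hd : Q.det = p2 * (-(Q 2 0) ^ 3) := by
    rw [Matrix.det_fin_three, hz 0 0 rfl, hz 0 1 rfl, hz 1 0 rfl, hz 1 2 rfl, hz 2 1 rfl,
      hz 2 2 rfl, h1, h2]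
    ring
  rw [hd] at hu
  exact not_isUnit_p2 (isUnit_of_mul_isUnit_left hu)

/-! ## The Specht module -/

theorem mon_zero_zero : mon 0 0 = 1 := rfl

theorem toA_mon (i j : ℤ) : toA [(i, j, 1)] = mon i j := by simp [toA, mon, eps]

theorem toA_neg_mon (i j : ℤ) : toA [(i, j, -1)] = -mon i j := by
  simp [toA, mon, eps, AddMonoidAlgebra.single_neg]

theorem toA_symm_p1 : toA (symm 1 1 (-1)) = p1 := by simp [toA, symm, p1, mon, eps]

/-! ### The elements `x_λ` -/

/-- The row lengths 1, 2 have partial sums 0, 1, 3, so s_2 is the only generator in the row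
stabiliser. -/
theorem rowSum_lam12 : rowSum lam12 = 1 + mon 0 1 • gB 2 := by
  have hs : (typeB 3).simple 2 * (typeB 3).simple 2 = 1 := csB.simple_mul_simple_self 2
  have hi : idx ((typeB 3).simple 2) = 3 := by
    have := idx_simple_mul 2 1
    rw [mul_one, idx_one] at this
    exact this.trans (by decide +kernel)
  have hne : (1 : WB 3) ≠ (typeB 3).simple 2 := fun h => by
    rw [← h, idx_one] at hi
    exact absurd hi (by decide)
  have hY : (youngSubgroup lam12 : Set (WB 3)) = {1, (typeB 3).simple 2} := by
    apply Set.Subset.antisymm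
    · intro w hw
      induction hw using Subgroup.closure_induction with
      | mem w h =>
        obtain ⟨i, h0, h1, rfl⟩ := h
        have h1' := h1 1
        fin_cases i
        · exact absurd rfl h0
        · exact absurd rfl h1'
        · exact Or.inr rfl
      | one => exact Or.inl rfl
      | mul x y _ _ hx hy =>
        rcases hx with rfl | rfl <;> rcases hy with rfl | rfl <;> simp [hs]
      | inv x _ hx =>
        rcases hx with rfl | rfl
        · simp
        · rw [inv_eq_of_mul_eq_one_left hs]; simp
    · rintro w (rfl | rfl)
      · exact Subgroup.one_mem _
      · refine Subgroup.subset_closure ⟨2, by decide, fun k => ?_, rfl⟩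
        rcases k with _ | _ | k
        · decide
        · decide
        · simp [lam12]
  have h3 : T (typeB 3) (weightB 3) ((typeB 3).simple 2) = gB 2 := by
    rw [T_eq_tB, hi, show (3 : Fin 48) = lm 2 0 by decide +kernel,
      ← gB_mul_tB_of_lt (by decide +kernel), tB_zero, mul_one]
  rw [rowSum, hY, finsum_mem_pair hne, h3, T_eq_tB, idx_one, tB_zero]
  simp only [CoxeterSystem.length_one]
  rw [show csB.length ((typeB 3).simple 2) = 1 from csB.length_simple 2, Nat.cast_zero,
    mon_zero_zero, one_smul, Nat.cast_one]

theorem djmGen_zero : djmGen 3 0 = mon 1 0 • gB 0 := rfl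

theorem djmGen_one : djmGen 3 1 = mon 0 1 • gB 1 := rfl

theorem uPlus_one : uPlus 3 1 = 1 + mon 1 0 • gB 0 := by
  simp [uPlus, List.range_succ, jucysMurphy, djmGen_zero, mon_zero_zero]

theorem uPlus_two :
    uPlus 3 2 = (1 + mon 1 0 • gB 0) * (mon 0 2 • 1 + mon 1 2 • (gB 1 * (gB 0 * gB 1))) := by
  rw [uPlus, List.range_succ, List.map_append, List.prod_append, ← uPlus, uPlus_one]
  have h1 : mon 1 2 = mon 0 1 * (mon 1 0 * mon 0 1) := by
    rw [mon_mul_mon, mon_mul_mon]; rfl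
  simp [jucysMurphy, djmGen_zero, djmGen_one, Algebra.algebraMap_eq_smul_one, h1, smul_smul,
    mul_assoc]

theorem uPlus_three : ∃ z, uPlus 3 3 = uPlus 3 2 * z := by
  refine ⟨algebraMap A (HB 3) (mon 0 (2 * (2 : ℕ))) + jucysMurphy 3 2, ?_⟩
  rw [uPlus, List.range_succ, List.map_append, List.prod_append, ← uPlus, List.map_singleton,
    List.prod_singleton]

theorem xElt_lam12 : xElt lam12 = (1 + mon 1 0 • gB 0) * (1 + mon 0 1 • gB 2) := by
  rw [xElt, rowSum_lam12, ← uPlus_one]; rfl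

/-- If |μ_1| ≤ 1, dominance at the first row of each component forces μ = λ. Consequently every x_μ
in N̂^λ has the left factor u_2^+. -/
theorem two_le_sum_fst {mu : Bipartition 3} (h : Dominated lam12 mu) (hne : lam12 ≠ mu) :
    2 ≤ mu.fst.sum := by
  obtain ⟨a, c, h1, h2, h3, h4, h5⟩ := mu
  obtain ⟨d1, d2⟩ := h
  have d1 := d1 1
  have d2 := d2 1
  by_contra h6
  refine hne ?_
  simp only [lam12] at d1 d2 h6
  have ha : a = [1] := by
    rcases a with _ | ⟨x, _ | ⟨y, l⟩⟩
    · simp at d1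
    · simp at d1 h6 ⊢; omega
    · have := h3 x (by simp)
      have := h3 y (by simp)
      simp at h6; omega
  subst ha
  have hc : c = [2] := by
    rcases c with _ | ⟨x, _ | ⟨y, l⟩⟩
    · simp at d2
    · simp at d2 h5 ⊢; omega
    · have := h4 y (by simp)
      simp at d2 h5; omega
  subst hc
  rfl

theorem exists_xElt_eq {mu : Bipartition 3} (h : Dominated lam12 mu) (hne : lam12 ≠ mu) :
    ∃ z, xElt mu = uPlus 3 2 * z := by
  have h1 := two_le_sum_fst h hne
  have h2 := mu.sum_eq
  obtain h3 | h3 : mu.fst.sum = 2 ∨ mu.fst.sum = 3 := by omega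
  · exact ⟨rowSum mu, by rw [xElt, h3]⟩
  · obtain ⟨z, hz⟩ := uPlus_three
    exact ⟨z * rowSum mu, by rw [xElt, h3, hz, mul_assoc]⟩

/-- The bipartition `((1, 1), (1))`. -/
def lam111 : Bipartition 3 where
  fst := [1, 1]
  snd := [1]
  fst_sorted := by simp
  snd_sorted := by simp
  fst_pos := by simp
  snd_pos := by simp
  sum_eq := by simp

theorem xElt_lam111 : xElt lam111 = uPlus 3 2 := by
  have hY : youngSubgroup lam111 = ⊥ := by
    rw [youngSubgroup, Subgroup.closure_eq_bot_iff]
    rintro w ⟨i, h0, h1, rfl⟩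
    have h1' := h1 1
    have h2' := h1 2
    fin_cases i
    · exact absurd rfl h0
    · exact absurd rfl h1'
    · exact absurd rfl h2'
  rw [xElt, rowSum, hY, Subgroup.coe_bot, finsum_mem_singleton, T_eq_tB, idx_one, tB_zero,
    CoxeterSystem.length_one, Nat.cast_zero, mon_zero_zero, one_smul, mul_one]
  rfl

/-- The bipartition ((1,1),(1)) dominates λ and its element is u_2^+. With `exists_xElt_eq` this
makes N̂^λ the two-sided ideal generated by u_2^+. -/
theorem uPlus_two_mul_mem (h : HB 3) : uPlus 3 2 * h ∈ spechtNHat lam12 := by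
  refine Submodule.subset_span ⟨lam111, ⟨fun j => ?_, fun j => ?_⟩, ?_, h, by rw [xElt_lam111]⟩
  · rcases j with _ | _ | _ | j <;> simp [lam12, lam111]
  · rcases j with _ | _ | j <;> simp [lam12, lam111]
  · intro h
    simpa [lam12, lam111] using congrArg Bipartition.fst h

/-! ### The left ideals in terms of the Kazhdan-Lusztig basis -/

/-- If `C_k` lies in a left ideal, then the product of `T_i` and `C_k` gives a further element of the
left ideal, when the other terms of the product are known to be in it. -/
def chainStep (m : MuTable) (S : List (Fin 48)) (x : Fin 48 × Fin 3) : List (Fin 48) :=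
  if x.1 ∈ S ∧ x.1 < lm x.2 x.1 ∧ ∀ e ∈ mus m x.2 x.1, e.1 ∈ S then lm x.2 x.1 :: S else S

/-- The numbers of elements of the Kazhdan-Lusztig basis in the left ideal generated by those with
numbers in a list. -/
def chain (m : MuTable) (S : List (Fin 48)) : List (Fin 48) :=
  ((List.finRange 48).flatMap fun k => (List.finRange 3).map fun i => (k, i)).foldl (chainStep m) S

section

variable {lt : ℤ × ℤ → ℤ × ℤ → Prop} {m : MuTable} {b : Module.Basis (Fin 48) A (HB 3)}

theorem IsWGraph.mem_of_mem_chainStep (hW : IsWGraph lt m b) {N : Submodule (HB 3) (HB 3)}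
    {S : List (Fin 48)} (hS : ∀ k ∈ S, b k ∈ N) (x : Fin 48 × Fin 3) :
    ∀ k ∈ chainStep m S x, b k ∈ N := by
  intro k hk
  rw [chainStep] at hk
  split_ifs at hk with h
  · obtain ⟨h1, h2, h3⟩ := h
    rcases List.mem_cons.1 hk with rfl | hk
    · have e := hW.mul x.2 x.1
      rw [col, if_neg (lt_asymm h2), List.map_cons, List.sum_cons, List.map_cons, List.sum_cons,
        toA_one, one_smul] at e
      rw [eq_sub_of_add_eq e.symm]
      refine N.sub_mem (N.smul_mem _ (hS _ h1)) (N.add_mem (N.smul_of_tower_mem _ (hS _ h1)) ?_)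
      refine list_sum_mem fun y hy => ?_
      obtain ⟨e, he, rfl⟩ := List.mem_map.1 hy
      exact N.smul_of_tower_mem _ (hS _ (h3 e he))
    · exact hS k hk
  · exact hS k hk

theorem IsWGraph.mem_of_mem_chain (hW : IsWGraph lt m b) {N : Submodule (HB 3) (HB 3)}
    {S : List (Fin 48)} (hS : ∀ k ∈ S, b k ∈ N) : ∀ k ∈ chain m S, b k ∈ N := by
  rw [chain]
  generalize ((List.finRange 48).flatMap fun k => (List.finRange 3).map fun i => (k, i)) = l
  induction l generalizing S with
  | nil => exact hS
  | cons x l ih => exact ih (hW.mem_of_mem_chainStep hS x)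

end

/-- The numbers of the elements below the left cell `Set.range asymElt`. -/
def lowerAsym : List (Fin 48) := [5, 13, 17, 22, 24, 26, 35, 36, 39, 43, 45, 47]

theorem lowerAsym_closed : ∀ k, k ∈ lowerAsym → ∀ i, ∀ e ∈ col muAsym i k, e.1 ∈ lowerAsym := by
  decide +kernel

theorem lowerAsym_chain : ∀ k ∈ lowerAsym, k ∈ chain muAsym [5] := by decide +kernel

/-- Number 17 is ts_1s_2t: its basis element alone generates all that lies strictly below the cell,
just as number 5, which is s_2t, generates the whole lower set. -/
theorem lowerAsym_chain_hat :
    ∀ k ∈ lowerAsym, (∀ j, asymIdx j ≠ k) → k ∈ chain muAsym [17] := by decide +kernel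

section

variable {b : Module.Basis (Fin 48) A (HB 3)}

theorem IsWGraph.gB_mul_two_terms {m : MuTable} {lt : ℤ × ℤ → ℤ × ℤ → Prop}
    (hW : IsWGraph lt m b) {i : Fin 3} {k z : Fin 48} {p q : ℤ}
    (h : col m i k = [(z, [(0, 0, 1)]), (k, [(p, q, -1)])]) :
    gB i * b k = b z - mon p q • b k := by
  rw [hW.mul, h]
  simp [toA_one, toA_neg_mon, sub_eq_add_neg]

theorem IsWGraph.gB_mul_one_term {m : MuTable} {lt : ℤ × ℤ → ℤ × ℤ → Prop}
    (hW : IsWGraph lt m b) {i : Fin 3} {k : Fin 48} {p q : ℤ}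
    (h : col m i k = [(k, [(p, q, 1)])]) : gB i * b k = mon p q • b k := by
  rw [hW.mul, h]
  simp [toA_mon]

variable (hW : IsWGraph ltAsym muAsym b)
include hW

/-- From C_s = T_s + v_s⁻¹ one has 1 + v_sT_s = v_sC_s, and C_tC_{s_2} = C_{s_2t}. -/
theorem xElt_lam12_eq : xElt lam12 = mon 1 1 • b 5 := by
  have h1 : gB 2 * b 0 = b 3 - mon 0 (-1) • b 0 := hW.gB_mul_two_terms (by decide +kernel)
  have h2 : gB 0 * b 3 = b 5 - mon (-1) 0 • b 3 := hW.gB_mul_two_terms (by decide +kernel)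
  have e1 : mon 0 1 * mon 0 (-1) = 1 := mon_mul_mon _ _ _ _
  have e2 : mon 1 0 * mon (-1) 0 = 1 := mon_mul_mon _ _ _ _
  have e3 : mon 1 1 = mon 0 1 * mon 1 0 := (mon_mul_mon 0 1 1 0).symm
  rw [hW.zero, mul_one] at h1
  have h3 : 1 + mon 0 1 • gB 2 = mon 0 1 • b 3 := by
    rw [h1, smul_sub, smul_smul, e1, one_smul, add_sub_cancel]
  rw [xElt_lam12, h3, mul_smul_comm, add_mul, one_mul, smul_mul_assoc, h2, smul_sub, smul_smul, e2,
    one_smul, add_sub_cancel, smul_smul, e3]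

theorem basis_mem_spechtNHat : b 17 ∈ spechtNHat lam12 := by
  have h3 : gB 1 * b 3 = b 7 - mon 0 (-1) • b 3 := hW.gB_mul_two_terms (by decide +kernel)
  have h7 : gB 1 * b 7 = mon 0 1 • b 7 := hW.gB_mul_one_term (by decide +kernel)
  have h5 : gB 1 * b 5 = b 13 - mon 0 (-1) • b 5 := hW.gB_mul_two_terms (by decide +kernel)
  have k3 : gB 0 * b 3 = b 5 - mon (-1) 0 • b 3 := hW.gB_mul_two_terms (by decide +kernel)
  have k5 : gB 0 * b 5 = mon 1 0 • b 5 := hW.gB_mul_one_term (by decide +kernel)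
  have k13 : gB 0 * b 13 = b 17 - mon (-1) 0 • b 13 + p1 • b 5 := by
    have e : col muAsym 0 13 = [(17, [(0, 0, 1)]), (13, [(-1, 0, -1)]), (5, symm 1 1 (-1))] := by
      decide +kernel
    rw [hW.mul, e]
    simp only [List.map_cons, List.map_nil, List.sum_cons, List.sum_nil, add_zero, toA_one,
      one_smul, toA_neg_mon, toA_symm_p1]
    module
  have e1 : mon 0 1 * mon 0 (-1) = 1 := mon_mul_mon _ _ _ _
  have e2 : mon 1 0 * mon (-1) 0 = 1 := mon_mul_mon _ _ _ _
  have e3 : mon 0 2 = mon 0 1 * mon 0 1 := (mon_mul_mon 0 1 0 1).symm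
  have e4 : mon 1 2 = mon 1 0 * (mon 0 1 * mon 0 1) := by
    rw [mon_mul_mon, mon_mul_mon]; rfl
  have e5 : p1 = mon 1 0 * mon 0 (-1) + mon (-1) 0 * mon 0 1 := by
    rw [mon_mul_mon, mon_mul_mon]; rfl
  have e6 : mon 2 2 = mon 1 0 * mon 1 0 * (mon 0 1 * mon 0 1) := by
    rw [mon_mul_mon, mon_mul_mon, mon_mul_mon]; rfl
  -- The factor `b 7 - mon 0 1 • b 3` is T_{s_1}⁻¹C_{s_2}, chosen so that the last T_{s_1} in u_2^+
  -- turns it into C_{s_2}.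
  have key : uPlus 3 2 * (b 7 - mon 0 1 • b 3) = mon 2 2 • b 17 := by
    rw [uPlus_two, e3, e4, e6]
    generalize mon 1 0 = V at *
    generalize mon 0 1 = v at *
    generalize mon (-1) 0 = V' at *
    generalize mon 0 (-1) = v' at *
    have y1 : gB 1 * (b 7 - v • b 3) = b 3 := by
      rw [mul_sub, mul_smul_comm, h7, h3, smul_sub, smul_smul, e1, one_smul]; abel
    have y2 : gB 1 * (gB 0 * b 3) = b 13 - v' • b 5 - V' • b 7 + (V' * v') • b 3 := by
      rw [k3, mul_sub, mul_smul_comm, h5, h3]; module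
    have y3 : ((v * v) • 1 + (V * (v * v)) • (gB 1 * (gB 0 * gB 1))) * (b 7 - v • b 3) =
        (v - v * v * v) • b 3 + (V * (v * v)) • b 13 - (V * v) • b 5 := by
      rw [add_mul, smul_mul_assoc, one_mul, smul_mul_assoc, mul_assoc, mul_assoc, y1, y2]
      match_scalars
      · linear_combination (-v * v) * e2
      · linear_combination (v * v * v') * e2 + v * e1
      · ring
      · linear_combination (-V * v) * e1
    rw [mul_assoc, y3, add_mul, one_mul, smul_mul_assoc, mul_sub, mul_add, mul_smul_comm, mul_smul_comm,
      mul_smul_comm, k3, k5, k13, e5]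
    match_scalars
    · linear_combination (-(v - v * v * v)) * e2
    · linear_combination (-(V * v * v)) * e2
    · linear_combination (V * V * V * v) * e1 + (V * v * v * v) * e2
    · ring
  have e7 : mon (-2) (-2) * mon 2 2 = 1 := mon_mul_mon _ _ _ _
  have h := (spechtNHat lam12).smul_of_tower_mem (mon (-2) (-2))
    (uPlus_two_mul_mem (b 7 - mon 0 1 • b 3))
  rwa [key, smul_smul, e7, one_smul] at h

theorem basis_mem_spechtM {k : Fin 48} (hk : k ∈ lowerAsym) : b k ∈ spechtM lam12 := by
  refine hW.mem_of_mem_chain (S := [5]) (fun k hk => ?_) k (lowerAsym_chain k hk)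
  rw [List.mem_singleton.1 hk]
  have e : mon (-1) (-1) * mon 1 1 = 1 := mon_mul_mon _ _ _ _
  have h : mon (-1) (-1) • xElt lam12 ∈ spechtM lam12 :=
    (spechtM lam12).smul_of_tower_mem _ (Submodule.subset_span rfl)
  rwa [xElt_lam12_eq hW, smul_smul, e, one_smul] at h

theorem idx_mem_lowerAsym {y : WB 3}
    (hy : ∃ w ∈ Set.range asymElt, LeftLE (typeB 3) (weightB 3) ltAsym y w) :
    idx y ∈ lowerAsym := by
  obtain ⟨_, ⟨j, rfl⟩, hj⟩ := hy
  refine hW.idx_mem_of_leftLE isLevel_asym.mus_zero lowerAsym_closed hj ?_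
  rw [idx_asymElt]
  revert j
  have : ∀ j, asymIdx j ∈ lowerAsym := by decide
  exact fun j _ => this j

theorem spechtM_eq : spechtM lam12 = cellIdeal (typeB 3) (weightB 3) ltAsym (Set.range asymElt) := by
  apply le_antisymm
  · rw [spechtM, Submodule.span_le, Set.singleton_subset_iff, xElt_lam12_eq hW]
    refine Submodule.smul_of_tower_mem _ _ (Submodule.subset_span
      ⟨asymElt 0, ⟨_, Set.mem_range_self 0, Relation.ReflTransGen.refl⟩, ?_⟩)
    rw [hW.C_eq, idx_asymElt]; rfl
  · rw [cellIdeal, Submodule.span_le]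
    rintro _ ⟨y, hy, rfl⟩
    rw [hW.C_eq]
    exact basis_mem_spechtM hW (idx_mem_lowerAsym hW hy)

theorem cellIdealHat_le : cellIdealHat (typeB 3) (weightB 3) ltAsym (Set.range asymElt) ≤
    spechtM lam12 ⊓ spechtNHat lam12 := by
  rw [cellIdealHat, Submodule.span_le]
  rintro _ ⟨y, hy, hyc, rfl⟩
  rw [hW.C_eq]
  have h1 := idx_mem_lowerAsym hW hy
  refine ⟨basis_mem_spechtM hW h1, hW.mem_of_mem_chain (S := [17]) (fun k hk => ?_) _
    (lowerAsym_chain_hat _ h1 fun j hj => hyc ⟨j, idx_injective (by rw [idx_asymElt, hj])⟩)⟩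
  rw [List.mem_singleton.1 hk]
  exact basis_mem_spechtNHat hW

end

/-! ### The action on a module affording `ρ_λ` -/

section

variable {X : Type*} [AddCommGroup X] [Module A X] [Module (HB 3) X] [IsScalarTower A (HB 3) X]
  {e : Module.Basis (Fin 3) A X} (he : ActsBy (typeB 3) (weightB 3) e rhoLam)
include he

/-- The vector e_0 is an eigenvector of T_t and T_{s_2} with eigenvalues V and v. -/
theorem xElt_lam12_smul :
    xElt lam12 • e 0 = ((mon 0 0 + mon 2 0) * (mon 0 0 + mon 0 2)) • e 0 := by
  have h0 : gB 0 • e 0 = mon 1 0 • e 0 := (he 0 0).trans (by simp [rhoLam, Fin.sum_univ_three])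
  have h2 : gB 2 • e 0 = mon 0 1 • e 0 := (he 2 0).trans (by simp [rhoLam, Fin.sum_univ_three])
  have e1 : mon 0 2 = mon 0 1 * mon 0 1 := (mon_mul_mon 0 1 0 1).symm
  have e2 : mon 2 0 = mon 1 0 * mon 1 0 := (mon_mul_mon 1 0 1 0).symm
  have k0 : (1 + mon 1 0 • gB 0) • e 0 = (1 + mon 1 0 * mon 1 0) • e 0 := by
    rw [add_smul, one_smul, smul_assoc, h0]; module
  have k2 : (1 + mon 0 1 • gB 2) • e 0 = (1 + mon 0 1 * mon 0 1) • e 0 := by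
    rw [add_smul, one_smul, smul_assoc, h2]; module
  rw [xElt_lam12, mul_smul, k2, smul_algebra_smul_comm, k0, mon_zero_zero, e1, e2, smul_smul,
    mul_comm]

/-- The image of 1 + VT_t lies in A e_0, and T_{s_1}T_tT_{s_1} acts on e_0 as -V⁻¹, so the other
factor of u_2^+, which commutes with the first, kills this image. The proof verifies the vanishing
on the three basis vectors. -/
theorem uPlus_two_smul (x : X) : uPlus 3 2 • x = 0 := by
  have g00 : gB 0 • e 0 = mon 1 0 • e 0 := (he 0 0).trans (by simp [rhoLam, Fin.sum_univ_three])
  have g01 : gB 0 • e 1 = p1 • e 0 - mon (-1) 0 • e 1 :=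
    (he 0 1).trans (by simp [rhoLam, Fin.sum_univ_three, sub_eq_add_neg])
  have g02 : gB 0 • e 2 = p2 • e 0 - mon (-1) 0 • e 2 :=
    (he 0 2).trans (by simp [rhoLam, Fin.sum_univ_three, sub_eq_add_neg])
  have g10 : gB 1 • e 0 = e 1 - mon 0 (-1) • e 0 :=
    (he 1 0).trans (by simp [rhoLam, Fin.sum_univ_three]; abel)
  have g11 : gB 1 • e 1 = mon 0 1 • e 1 := (he 1 1).trans (by simp [rhoLam, Fin.sum_univ_three])
  have g12 : gB 1 • e 2 = mon 0 1 • e 2 := (he 1 2).trans (by simp [rhoLam, Fin.sum_univ_three])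
  have e1 : mon 0 1 * mon 0 (-1) = 1 := mon_mul_mon _ _ _ _
  have e2 : mon 1 0 * mon (-1) 0 = 1 := mon_mul_mon _ _ _ _
  have e3 : mon 0 2 = mon 0 1 * mon 0 1 := (mon_mul_mon 0 1 0 1).symm
  have e4 : mon 1 2 = mon 1 0 * (mon 0 1 * mon 0 1) := by
    rw [mon_mul_mon, mon_mul_mon]; rfl
  have e5 : p1 = mon 1 0 * mon 0 (-1) + mon (-1) 0 * mon 0 1 := by
    rw [mon_mul_mon, mon_mul_mon]; rfl
  have hc (i : Fin 3) (a : A) (x : X) : gB i • a • x = a • gB i • x :=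
    smul_algebra_smul_comm a (gB i) x
  have key : ∀ j, uPlus 3 2 • e j = 0 := by
    rw [uPlus_two, e3, e4]
    generalize mon 1 0 = V at *
    generalize mon 0 1 = v at *
    generalize mon (-1) 0 = V' at *
    generalize mon 0 (-1) = v' at *
    generalize p2 = q at *
    have z0 : gB 1 • gB 0 • gB 1 • e 0 = -V' • e 0 := by
      simp only [g10, smul_sub, hc, g01, g00, g11, e5]
      match_scalars
      · ring
      · linear_combination (-V') * e1
    have z1 : gB 1 • gB 0 • gB 1 • e 1 = V • e 1 - (V * v' + V' * v) • e 0 := by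
      simp only [g11, hc, g01, smul_sub, g10, e5]
      match_scalars
      · linear_combination V * e1
      · linear_combination (-(V * v' + V' * v)) * e1
    have z2 : gB 1 • gB 0 • gB 1 • e 2 = (v * q) • e 1 - q • e 0 - (V' * v * v) • e 2 := by
      simp only [g12, hc, g02, smul_sub, g10]
      match_scalars
      · ring
      · linear_combination (-q) * e1
      · ring
    intro j
    fin_cases j <;>
    simp only [Fin.zero_eta, Fin.mk_one, Fin.reduceFinMk, mul_smul _ _ (e _), add_smul _ _ (e _), one_smul,
      smul_assoc, z0, z1, z2]
    all_goals simp only [add_smul, one_smul, smul_assoc, smul_add, smul_sub, hc, g00, g01, g02, e5]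
    · match_scalars
      linear_combination (-(v * v) * (1 + V * V)) * e2
    · match_scalars
      · linear_combination (-(v * v + V * V * v * v)) * e2
      · ring
    · match_scalars
      · linear_combination (-(v * v - V * V' * (v * v * v * v))) * e2
      · linear_combination (V * V * V * v * v * q) * e1
      · linear_combination (-(V * v * v * v * q)) * e2
  rw [← e.sum_repr x, Finset.smul_sum]
  refine Finset.sum_eq_zero fun j _ => ?_
  rw [smul_algebra_smul_comm, key, smul_zero]

theorem smul_eq_zero_of_mem_spechtNHat {h : HB 3} (hh : h ∈ spechtNHat lam12) (x : X) :
    h • x = 0 := by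
  induction hh using Submodule.span_induction with
  | mem y hy =>
    obtain ⟨mu, h1, h2, h', rfl⟩ := hy
    obtain ⟨z, hz⟩ := exists_xElt_eq h1 h2
    rw [hz, mul_assoc, mul_smul, uPlus_two_smul he]
  | zero => exact zero_smul _ x
  | add y z _ _ hy hz => rw [add_smul, hy, hz, add_zero]
  | smul a y _ hy => rw [smul_assoc, hy, smul_zero]

end

/-- If a x_λ ∈ N̂^λ, then a x_λ kills e_0. As x_λ e_0 is a non-zero scalar multiple of e_0 and the
module is free over A, a e_0 = 0. The class of a x_λ in the cell module is Vv a e_0, which is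
therefore zero. -/
theorem inf_le_cellIdealHat : spechtM lam12 ⊓ spechtNHat lam12 ≤
    cellIdealHat (typeB 3) (weightB 3) ltAsym (Set.range asymElt) := by
  obtain ⟨b, hW⟩ := exists_isWGraph_asym
  obtain ⟨e, he, hact⟩ := exists_basis_asym
  rintro h ⟨hM, hN⟩
  obtain ⟨a, rfl⟩ := Submodule.mem_span_singleton.1 hM
  have h1 : (mon 0 0 + mon 2 0) * (mon 0 0 + mon 0 2) ≠ 0 :=
    mul_ne_zero (mon_add_mon_ne_zero (Or.inl (by decide)))
      (mon_add_mon_ne_zero (Or.inr (by decide)))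
  have h2 := smul_eq_zero_of_mem_spechtNHat hact hN (e 0)
  rw [smul_eq_mul, mul_smul, xElt_lam12_smul hact, smul_algebra_smul_comm, e.smul_eq_zero] at h2
  have h3 := h2.resolve_left h1
  have hx : xElt lam12 ∈ cellIdeal (typeB 3) (weightB 3) ltAsym (Set.range asymElt) :=
    spechtM_eq hW ▸ Submodule.subset_span rfl
  have h4 : (Submodule.Quotient.mk ⟨xElt lam12, hx⟩ : CellModuleB3 ltAsym (Set.range asymElt)) =
      mon 1 1 • e 0 := by
    rw [he 0, cellClass, ← Submodule.Quotient.mk_smul]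
    congr 1
    refine Subtype.ext ?_
    change xElt lam12 = mon 1 1 • C (typeB 3) (weightB 3) ltAsym (asymElt 0)
    rw [hW.C_eq, xElt_lam12_eq hW, idx_asymElt]
    rfl
  have h5 : a • (Submodule.Quotient.mk ⟨xElt lam12, hx⟩ :
      CellModuleB3 ltAsym (Set.range asymElt)) = 0 := by
    rw [h4, smul_algebra_smul_comm, h3, smul_zero]
  rw [← Submodule.Quotient.mk_smul, Submodule.Quotient.mk_eq_zero] at h5
  exact h5

theorem nonempty_quotient_equiv {R Y : Type*} [Ring R] [AddCommGroup Y] [Module R Y]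
    {I I' J J' : Submodule R Y} (h : I = I') (h' : J = J') :
    Nonempty ((I ⧸ J.submoduleOf I) ≃ₗ[R] (I' ⧸ J'.submoduleOf I')) := by
  subst h h'
  exact ⟨LinearEquiv.refl _ _⟩

theorem nonempty_specht_equiv :
    Nonempty (Specht lam12 ≃ₗ[HB 3] CellModuleB3 ltAsym (Set.range asymElt)) := by
  obtain ⟨b, hW⟩ := exists_isWGraph_asym
  exact nonempty_quotient_equiv (spechtM_eq hW)
    (le_antisymm inf_le_cellIdealHat (cellIdealHat_le hW))

/-! ## Isomorphisms over the field of fractions -/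

section

variable {X Y : Type*} [AddCommGroup X] [Module A X] [Module (HB 3) X] [IsScalarTower A (HB 3) X]
  [AddCommGroup Y] [Module A Y] [Module (HB 3) Y] [IsScalarTower A (HB 3) Y]

theorem isoOverFractions_of_bijective (φ : X →ₗ[A] Y) (hφ : ∀ (h : HB 3) x, φ (h • x) = h • φ x)
    (f : (K ⊗[A] X) ≃ₗ[K] (K ⊗[A] Y)) (hf : ∀ x, f x = φ.baseChange K x) :
    IsoOverFractions (typeB 3) (weightB 3) X Y := by
  refine ⟨f, fun h x => ?_⟩
  rw [hf, hf, ← LinearMap.comp_apply, ← LinearMap.comp_apply, ← LinearMap.baseChange_comp,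
    ← LinearMap.baseChange_comp]
  congr 2
  exact LinearMap.ext fun x => hφ h x

theorem isoOverFractions_of_equiv (f : X ≃ₗ[HB 3] Y) :
    IsoOverFractions (typeB 3) (weightB 3) X Y :=
  isoOverFractions_of_bijective (f.restrictScalars A).toLinearMap (fun h x => f.map_smul h x)
    ((f.restrictScalars A).baseChange A K X Y) fun _ => rfl

variable {ι ι' : Type*} [Fintype ι] [Fintype ι']

theorem trace_eq_of_isoOverFractions (e : Module.Basis ι A X) (e' : Module.Basis ι' A Y)
    (h : IsoOverFractions (typeB 3) (weightB 3) X Y) (a : HB 3) :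
    LinearMap.trace A X (Algebra.lsmul A A X a) = LinearMap.trace A Y (Algebra.lsmul A A Y a) := by
  obtain ⟨f, hf⟩ := h
  have := Module.Free.of_basis e
  have := Module.Free.of_basis e'
  have := Module.Finite.of_basis e
  have := Module.Finite.of_basis e'
  apply IsFractionRing.injective A K
  rw [← LinearMap.trace_baseChange, ← LinearMap.trace_baseChange, ← LinearMap.trace_conj' _ f]
  congr 1
  refine LinearMap.ext fun x => ?_
  rw [LinearEquiv.conj_apply_apply, hf, LinearEquiv.apply_symm_apply]

variable [DecidableEq ι] [DecidableEq ι']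

theorem toMatrix_eq_of_actsBy {e : Module.Basis ι A X} {ρ : Fin 3 → Matrix ι ι A}
    (he : ActsBy (typeB 3) (weightB 3) e ρ) (i : Fin 3) :
    LinearMap.toMatrix e e (Algebra.lsmul A A X (gB i)) = ρ i := by
  refine Matrix.ext fun k j => ?_
  rw [LinearMap.toMatrix_apply]
  change e.repr (gB i • e j) k = ρ i k j
  rw [he i j, e.repr_sum_self]

theorem map_smul_of_matrix {e : Module.Basis ι A X} {e' : Module.Basis ι' A Y}
    {ρ : Fin 3 → Matrix ι ι A} {ρ' : Fin 3 → Matrix ι' ι' A}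
    (he : ActsBy (typeB 3) (weightB 3) e ρ) (he' : ActsBy (typeB 3) (weightB 3) e' ρ')
    {P : Matrix ι' ι A} (hP : ∀ i, P * ρ i = ρ' i * P) (h : HB 3) :
    ∀ x, Matrix.toLin e e' P (h • x) = h • Matrix.toLin e e' P x := by
  induction h using hecke_induction with
  | hA a => intro x; rw [algebraMap_smul, algebraMap_smul, map_smul]
  | hg i =>
    have h1 : Matrix.toLin e e' P ∘ₗ (Algebra.lsmul A A X (gB i)) =
        (Algebra.lsmul A A Y (gB i)) ∘ₗ Matrix.toLin e e' P := by
      apply (LinearMap.toMatrix e e').injective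
      rw [LinearMap.toMatrix_comp e e e', LinearMap.toMatrix_comp e e' e',
        LinearMap.toMatrix_toLin, toMatrix_eq_of_actsBy he, toMatrix_eq_of_actsBy he', hP]
    exact fun x => LinearMap.congr_fun h1 x
  | hm y z hy hz => intro x; rw [mul_smul, hy, hz, mul_smul]
  | ha y z hy hz => intro x; rw [add_smul, map_add, hy, hz, add_smul]

theorem isoOverFractions_of_matrix {e : Module.Basis ι A X} {e' : Module.Basis ι A Y}
    {ρ ρ' : Fin 3 → Matrix ι ι A}
    (he : ActsBy (typeB 3) (weightB 3) e ρ) (he' : ActsBy (typeB 3) (weightB 3) e' ρ')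
    {P : Matrix ι ι A} (hP : ∀ i, P * ρ i = ρ' i * P) (hdet : P.det ≠ 0) :
    IsoOverFractions (typeB 3) (weightB 3) X Y := by
  have hu : IsUnit (LinearMap.toMatrix (Algebra.TensorProduct.basis K e)
      (Algebra.TensorProduct.basis K e')
      ((Matrix.toLin e e' P).baseChange K)).det := by
    rw [LinearMap.toMatrix_baseChange, LinearMap.toMatrix_toLin, ← RingHom.mapMatrix_apply,
      ← RingHom.map_det, isUnit_iff_ne_zero]
    exact (map_ne_zero_iff _ (IsFractionRing.injective A K)).2 hdet
  exact isoOverFractions_of_bijective _ (map_smul_of_matrix he he' hP)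
    (LinearEquiv.ofIsUnitDet hu) fun x => rfl

theorem trace_eq_sum {e : Module.Basis ι A X} {a : HB 3} {c : ι → ι → A}
    (h : ∀ j, a • e j = ∑ k, c j k • e k) :
    LinearMap.trace A X (Algebra.lsmul A A X a) = ∑ j, c j j := by
  rw [LinearMap.trace_eq_matrix_trace A e]
  refine Finset.sum_congr rfl fun j _ => ?_
  rw [Matrix.diag_apply, LinearMap.toMatrix_apply]
  change e.repr (a • e j) j = c j j
  rw [h, e.repr_sum_self]

end

theorem exists_basis_specht : ∃ e : Module.Basis (Fin 3) A (Specht lam12),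
    ActsBy (typeB 3) (weightB 3) e rhoLam := by
  obtain ⟨f⟩ := nonempty_specht_equiv
  obtain ⟨e, -, he⟩ := exists_basis_asym
  refine ⟨e.map (f.symm.restrictScalars A), fun i j => ?_⟩
  have h := congrArg f.symm (he i j)
  rw [map_smul, map_sum] at h
  refine h.trans (Finset.sum_congr rfl fun k _ => ?_)
  exact (f.symm.restrictScalars A).map_smul _ _

theorem det_matP : matP.det = -p2 := by
  simp [matP, Matrix.det_fin_three]

/-! ## The left cells whose modules agree with the Specht module -/

/-- Adds to `q` the trace of `T_i` on the module of the left cell of the element number `k₀`. -/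
def addTrace (m : MuTable) (lev : Fin 48 → ℕ) (i : Fin 3) (k₀ : Fin 48) (q : LPoly) : LPoly :=
  (List.finRange 48).foldr
    (fun k q => if lev k = lev k₀ then addMul 0 0 1 (entry (col m i k) k) q else q) q

theorem toA_addTrace (m : MuTable) (lev : Fin 48 → ℕ) (i : Fin 3) (k₀ : Fin 48) (q : LPoly) :
    toA (addTrace m lev i k₀ q) = ∑ k : {k // lev k = lev k₀}, coef m i k k + toA q := by
  have e1 : AddMonoidAlgebra.single ((0, 0) : ℤ × ℤ) (1 : ℤ) = (1 : A) := rfl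
  have key : ∀ l : List (Fin 48), toA (l.foldr (fun k q => if lev k = lev k₀ then
      addMul 0 0 1 (entry (col m i k) k) q else q) q) =
      (l.map fun k => if lev k = lev k₀ then coef m i k k else 0).sum + toA q := by
    intro l
    induction l with
    | nil => simp
    | cons k l ih =>
      rw [List.foldr_cons, List.map_cons, List.sum_cons]
      split_ifs with h
      · rw [toA_addMul, ih, e1, one_mul, add_assoc]; rfl
      · rw [ih, zero_add]
  rw [addTrace, key, ← List.ofFn_eq_map, List.sum_ofFn, ← Finset.sum_filter,
    Finset.sum_subtype _ (p := fun k => lev k = lev k₀) (by simp)]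

/-- The initial lists are the negatives of the traces V - 2V⁻¹ and 2v - v⁻¹ of ρ_λ(T_t) and
ρ_λ(T_{s_1}). So for every cell other than the three, one of the two traces differs from that of the
Specht module. -/
theorem trace_distinguishes : ∀ k₀, (∃ k, levWeighted k₀ = levWeighted (weightedIdx k 0)) ∨
    headSurvives (addTrace muWeighted levWeighted 0 k₀ [(1, 0, -1), (-1, 0, 2)]) = true ∨
    headSurvives (addTrace muWeighted levWeighted 1 k₀ [(0, 1, -2), (0, -1, 1)]) = true := by
  decide +kernel

theorem exists_eq_range_of_isoOverFractions {c : Set (WB 3)}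
    (hc : IsLeftCell (typeB 3) (weightB 3) ltWeighted c)
    (h : IsoOverFractions (typeB 3) (weightB 3) (Specht lam12) (CellModuleB3 ltWeighted c)) :
    ∃ k : Fin 3, c = Set.range (weightedElt k) := by
  obtain ⟨b, hW⟩ := exists_isWGraph_weighted
  obtain ⟨k₀, hk₀⟩ := (hW.isLeftCell_iff isLevel_weighted c).1 hc
  obtain ⟨e, he⟩ := exists_basis_specht
  obtain ⟨e', -, he'⟩ := hW.exists_cellBasis isLevel_weighted.mus_zero hc
    (fun k : {k // levWeighted k = levWeighted k₀} => elem k)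
    (fun k k' h => Subtype.ext (idxEquiv.symm.injective h))
    (fun k => by rw [hk₀]; exact (congrArg levWeighted (idx_elem k)).trans k.2)
    (fun y hy => ⟨⟨idx y, by rwa [hk₀] at hy⟩, elem_idx y⟩)
  have ht (i : Fin 3) : ∑ k : {k // levWeighted k = levWeighted k₀}, coef muWeighted i k k =
      ∑ j, rhoLam i j j := by
    rw [← trace_eq_sum fun j => he i j, trace_eq_of_isoOverFractions e e' h, trace_eq_sum (he' i)]
    simp only [idx_elem]
  have e2 (γ : ℤ × ℤ) : (AddMonoidAlgebra.single γ 2 : A) =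
      AddMonoidAlgebra.single γ 1 + AddMonoidAlgebra.single γ 1 := by
    rw [← AddMonoidAlgebra.single_add, one_add_one_eq_two]
  rcases trace_distinguishes k₀ with ⟨k, hk⟩ | h0 | h1
  · exact ⟨k, by rw [range_weightedElt, hk₀, hk]⟩
  · refine absurd ?_ (toA_ne_zero h0)
    rw [toA_addTrace, ht]
    simp [Fin.sum_univ_three, rhoLam, toA_cons, toA_nil, mon, eps]
    rw [e2]
    abel
  · refine absurd ?_ (toA_ne_zero h1)
    rw [toA_addTrace, ht]
    simp [Fin.sum_univ_three, rhoLam, toA_cons, toA_nil, mon, eps]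
    rw [e2]
    abel

theorem isoOverFractions_iff {c : Set (WB 3)}
    (hc : IsLeftCell (typeB 3) (weightB 3) ltWeighted c) :
    IsoOverFractions (typeB 3) (weightB 3) (Specht lam12) (CellModuleB3 ltWeighted c) ↔
      ∃ k : Fin 3, c = Set.range (weightedElt k) := by
  refine ⟨exists_eq_range_of_isoOverFractions hc, ?_⟩
  rintro ⟨k, rfl⟩
  obtain ⟨e, he⟩ := exists_basis_specht
  obtain ⟨e', -, he'⟩ := exists_basis_weighted k
  exact isoOverFractions_of_matrix he he' matP_mul_rhoLam
    (by rw [det_matP]; exact neg_ne_zero.2 p2_ne_zero)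

/-- An isomorphism over A extends to K, so the cell is one of the three. Its matrix in the two bases
is then an intertwiner with unit determinant, which no multiple of P is. -/
theorem isEmpty_specht_equiv {c : Set (WB 3)}
    (hc : IsLeftCell (typeB 3) (weightB 3) ltWeighted c) :
    IsEmpty (Specht lam12 ≃ₗ[HB 3] CellModuleB3 ltWeighted c) := by
  refine ⟨fun f => ?_⟩
  obtain ⟨k, rfl⟩ := (isoOverFractions_iff hc).1 (isoOverFractions_of_equiv f)
  obtain ⟨e, he⟩ := exists_basis_specht
  obtain ⟨e', -, he'⟩ := exists_basis_weighted k
  let φ := f.restrictScalars A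
  have hQ (i : Fin 3) : LinearMap.toMatrix e e' φ * rhoLam i = rho i * LinearMap.toMatrix e e' φ := by
    rw [← toMatrix_eq_of_actsBy he, ← toMatrix_eq_of_actsBy he', ← LinearMap.toMatrix_comp,
      ← LinearMap.toMatrix_comp]
    congr 1
    exact LinearMap.ext fun x => f.map_smul _ x
  obtain ⟨a, ha⟩ := intertwiner_unique ((LinearMap.toMatrix e e' φ).map (algebraMap A K))
    fun i => by rw [← Matrix.map_mul, hQ, Matrix.map_mul]
  exact not_isUnit_det_of_map_eq ⟨a, _, ha, LinearEquiv.isUnit_det φ e e'⟩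

end KazhdanLusztig

end

open KazhdanLusztig in
theorem mainTheorem7 :
    -- the asymptotic left cell and its representation, which is that of the Specht module
    (IsLeftCell (typeB 3) (weightB 3) ltAsym (Set.range asymElt) ∧
      Nonempty (Specht lam12 ≃ₗ[HB 3] CellModuleB3 ltAsym (Set.range asymElt)) ∧
      ∃ b : Module.Basis (Fin 3) A (CellModuleB3 ltAsym (Set.range asymElt)),
        (∀ j, b j = cellClass (typeB 3) (weightB 3) ltAsym (Set.range asymElt) (asymElt j)
          (Set.mem_range_self j)) ∧
        ActsBy (typeB 3) (weightB 3) b rhoLam) ∧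
    -- three distinct left cells for the weighted order, and their common representation
    (Function.Injective (fun k => Set.range (weightedElt k)) ∧
      ∀ k : Fin 3,
        IsLeftCell (typeB 3) (weightB 3) ltWeighted (Set.range (weightedElt k)) ∧
        ∃ b : Module.Basis (Fin 3) A (CellModuleB3 ltWeighted (Set.range (weightedElt k))),
          (∀ j, b j = cellClass (typeB 3) (weightB 3) ltWeighted (Set.range (weightedElt k))
            (weightedElt k j) (Set.mem_range_self j)) ∧
          ActsBy (typeB 3) (weightB 3) b rho) ∧
    -- these are the only left cells whose modules agree with the Specht module over `K`
    (∀ c : Set (WB 3), IsLeftCell (typeB 3) (weightB 3) ltWeighted c →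
      (IsoOverFractions (typeB 3) (weightB 3) (Specht lam12) (CellModuleB3 ltWeighted c) ↔
        ∃ k : Fin 3, c = Set.range (weightedElt k))) ∧
    -- the intertwiner, its uniqueness up to scalars, and the determinants of its multiples
    (∀ i : Fin 3, matP * rhoLam i = rho i * matP) ∧
    (∀ Q : Matrix (Fin 3) (Fin 3) K,
      (∀ i : Fin 3, Q * (rhoLam i).map (algebraMap A K) = (rho i).map (algebraMap A K) * Q) →
        ∃ a : K, Q = a • matP.map (algebraMap A K)) ∧
    (¬ ∃ (a : K) (Q : Matrix (Fin 3) (Fin 3) A),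
      Q.map (algebraMap A K) = a • matP.map (algebraMap A K) ∧ IsUnit Q.det) ∧
    -- no Kazhdan-Lusztig cell module for the weighted order is isomorphic to the Specht module
    (∀ c : Set (WB 3), IsLeftCell (typeB 3) (weightB 3) ltWeighted c →
      IsEmpty (Specht lam12 ≃ₗ[HB 3] CellModuleB3 ltWeighted c)) :=
  ⟨⟨isLeftCell_asym, nonempty_specht_equiv, exists_basis_asym⟩,
    ⟨range_weightedElt_injective, fun k => ⟨isLeftCell_weighted k, exists_basis_weighted k⟩⟩,
    fun _ hc => isoOverFractions_iff hc, matP_mul_rhoLam, intertwiner_unique,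
    not_isUnit_det_of_map_eq, fun _ hc => isEmpty_specht_equiv hc⟩
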